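/- Let $n\ge 0$, $e>0$, let $S=\mathbb{C}[x_0,\dots,x_n]$ with its standard grading $S=\bigoplus_k S_k$, and let $\mathbf f=(f_0,\dots,f_n)$ with $f_j\in S_e$ for all $j$. Assume that the ideal $J_{\mathbf f}=(f_0,\dots,f_n)$ is a 1-dimensional complete intersection, i.e. $\dim S/J_{\mathbf f}=1$ and $(f_1,\dots,f_n)$ is a regular sequence in $S$. Let $\Omega^k$ be the $S$-module of polynomial $k$-forms on $\mathbb{C}^{n+1}$ (with $\Omega^{-1}=0$), let $\omega=f_0\,dx_0+\dots+f_n\,dx_n$, and put $$AR(\mathbf f)=\ker\{\omega\wedge:\Omega^n\to\Omega^{n+1}\},\quad KR(\mathbf f)=\operatorname{im}\{\omega\wedge:\Omega^{n-1}\to\Omega^n\},\quad ER(\mathbf f)=AR(\mathbf f)/KR(\mathbf f).$$ For $m\geq 0$ let $ER(\mathbf f)_m$ be the space of classes of those elements of $AR(\mathbf f)$ all of whose coefficients lie in $S_m$ (equivalently, of relations $a_0f_0+\dots+a_nf_n=0$ with $a_j\in S_m$, modulo the Koszul relations). Let $Y(\mathbf f)\subset\mathbb{P}^n$ be the closed subscheme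 defined by $J_{\mathbf f}$. Then its support $|Y(\mathbf f)|$ is finite, each local ring $\mathcal{O}_{Y(\mathbf f),p}$ is Artinian, and, with $m_p$ the maximal ideal of $\mathcal{O}_{Y(\mathbf f),p}$ and $o(m_p)$ the smallest integer $k>0$ such that $m_p^k=0$, $$ER(\mathbf f)_m=0\quad\text{for every integer } m\ge 0 \text{ with } m\le n(e-1)-\sum_{p\in|Y(\mathbf f)|}o(m_p).$$ -/

import Mathlib

noncomputable section

namespace EssentialRelations

/-- The polynomial ring `S = ℂ[x₀, …, xₙ]`. -/
abbrev S (n : ℕ) : Type := MvPolynomial (Fin (n + 1)) ℂ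

/-- The standard grading of `S`: `grading n k` is `S_k`. -/
abbrev grading (n : ℕ) : ℕ → Submodule ℂ (S n) :=
  MvPolynomial.homogeneousSubmodule (Fin (n + 1)) ℂ

instance gradedAlgebraS (n : ℕ) : GradedAlgebra (grading n) := MvPolynomial.gradedAlgebra

/-- The module `Ω¹` of polynomial 1-forms, free on `dx₀, …, dxₙ`; the form `∑ aᵢ dxᵢ` is the
vector `(a₀, …, aₙ)`. -/
abbrev OneForms (n : ℕ) : Type := Fin (n + 1) → S n

/-- The algebra of polynomial differential forms on `ℂⁿ⁺¹`. -/
abbrev Forms (n : ℕ) : Type := ExteriorAlgebra (S n) (OneForms n)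

/-- The module `Ωᵏ` of polynomial `k`-forms. -/
abbrev kForms (n k : ℕ) : Submodule (S n) (Forms n) := ⋀[S n]^k (OneForms n)

/-- The 1-form `dxᵢ`. -/
def dx {n : ℕ} (i : Fin (n + 1)) : OneForms n := Pi.single i 1

/-- The 1-form `ω = f₀ dx₀ + ⋯ + fₙ dxₙ`. -/
def omega {n : ℕ} (f : Fin (n + 1) → S n) : OneForms n := ∑ i, f i • dx i

/-- Left exterior multiplication `ω ∧ ·`. -/
def wedge {n : ℕ} (f : Fin (n + 1) → S n) : Forms n →ₗ[S n] Forms n :=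
  LinearMap.mulLeft (S n) (ExteriorAlgebra.ι (S n) (omega f))

/-- All relations: the kernel of `ω ∧ · : Ωⁿ → Ωⁿ⁺¹`. -/
def AR {n : ℕ} (f : Fin (n + 1) → S n) : Submodule (S n) (Forms n) :=
  kForms n n ⊓ LinearMap.ker (wedge f)

/-- Koszul relations: the image of `ω ∧ · : Ωⁿ⁻¹ → Ωⁿ` (with `Ω⁻¹ = 0`). -/
def KR : {n : ℕ} → (Fin (n + 1) → S n) → Submodule (S n) (Forms n)
  | 0, _ => ⊥
  | k + 1, f => (kForms (k + 1) k).map (wedge f)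

/-- Essential relations: `ER(f) = AR(f) / KR(f)`. -/
abbrev ER {n : ℕ} (f : Fin (n + 1) → S n) : Type :=
  ↥(AR f) ⧸ (KR f).submoduleOf (AR f)

/-- The `n`-forms whose coefficients are homogeneous of degree `m`. -/
def homogeneousForms (n m : ℕ) : Submodule ℂ (Forms n) :=
  Submodule.span ℂ {η | ∃ a ∈ grading n m, ∃ s : Fin n → Fin (n + 1),
    η = a • ExteriorAlgebra.ιMulti (S n) n (fun i => dx (s i))}

/-- The graded piece `ER(f)_m`: classes of relations with coefficients in `S_m`. -/
def ERdeg {n : ℕ} (f : Fin (n + 1) → S n) (m : ℕ) : Submodule ℂ (ER f) :=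
  ((homogeneousForms n m).comap ((AR f).subtype.restrictScalars ℂ)).map
    (((KR f).submoduleOf (AR f)).mkQ.restrictScalars ℂ)

/-- The ideal `J_f = (f₀, …, fₙ)`. -/
def J {n : ℕ} (f : Fin (n + 1) → S n) : Ideal (S n) := Ideal.span (Set.range f)

/-- `J_f` is a 1-dimensional complete intersection: `dim S/J_f = 1` and `(f₁, …, fₙ)` is a
regular sequence. -/
def IsOneDimCI {n : ℕ} (f : Fin (n + 1) → S n) : Prop :=
  ringKrullDim (S n ⧸ J f) = 1 ∧
    RingTheory.Sequence.IsRegular (S n) (List.ofFn fun i : Fin n => f i.succ)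

/-- The support `|Y(f)|`: the points of `ℙⁿ = Proj S` at which all `fⱼ` vanish. -/
def support {n : ℕ} (f : Fin (n + 1) → S n) : Set (ProjectiveSpectrum (grading n)) :=
  ProjectiveSpectrum.zeroLocus (grading n) (J f)

/-- The local ring of `ℙⁿ` at `p`: degree zero fractions with denominator outside `p`. -/
abbrev ambientLocalRing {n : ℕ} (p : ProjectiveSpectrum (grading n)) : Type :=
  HomogeneousLocalization.AtPrime (grading n) p.asHomogeneousIdeal.toIdeal

/-- The stalk at `p` of the ideal sheaf of `Y(f)`: the degree zero part of `J_f · S_p`. -/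
def idealStalk {n : ℕ} (f : Fin (n + 1) → S n) (p : ProjectiveSpectrum (grading n)) :
    Ideal (ambientLocalRing p) :=
  ((J f).map (algebraMap (S n) (Localization.AtPrime p.asHomogeneousIdeal.toIdeal))).comap
    (algebraMap (ambientLocalRing p) (Localization.AtPrime p.asHomogeneousIdeal.toIdeal))

/-- The local ring of the scheme `Y(f)` at a point `p` of its support. -/
abbrev localRing {n : ℕ} (f : Fin (n + 1) → S n) (p : support f) : Type :=
  ambientLocalRing p.1 ⧸ idealStalk f p.1

instance nontrivial_localRing {n : ℕ} (f : Fin (n + 1) → S n) (p : support f) :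
    Nontrivial (localRing f p) := by
  apply Ideal.Quotient.nontrivial_iff.mpr
  refine Ideal.comap_ne_top _ fun h => ?_
  have hp : J f ≤ p.1.asHomogeneousIdeal.toIdeal := p.2
  have h1 := Ideal.map_mono
    (f := algebraMap (S n) (Localization.AtPrime p.1.asHomogeneousIdeal.toIdeal)) hp
  rw [h, Localization.AtPrime.map_eq_maximalIdeal, top_le_iff] at h1
  exact (IsLocalRing.maximalIdeal.isMaximal _).ne_top h1

instance isLocalRing_localRing {n : ℕ} (f : Fin (n + 1) → S n) (p : support f) :
    IsLocalRing (localRing f p) :=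
  IsLocalRing.of_surjective' (Ideal.Quotient.mk (idealStalk f p.1)) Ideal.Quotient.mk_surjective

/-- The order `o(m_p)`: the smallest `k > 0` such that `m_p ^ k = 0`. -/
def order {n : ℕ} (f : Fin (n + 1) → S n) (p : support f) : ℕ :=
  sInf {k | 0 < k ∧ IsLocalRing.maximalIdeal (localRing f p) ^ k = ⊥}

end EssentialRelations

end

noncomputable section

namespace EssentialRelations

open MvPolynomial DirectSum IsLocalRing

variable {n : ℕ}

/-! Put `I = (f₁, …, fₙ)`. Since `f₁, …, fₙ` is regular, a relation is Koszul as soon as its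
coefficient `a` at `f₀` lies in `I` (`mem_koszul_of_mem_adjoinSeq`). So it suffices that a form `a`
of degree `m` with `a * f₀ ∈ I` lies in `I` (`mem_adjoinSeq_of_mul_mem`).

Suppose `a ∉ I`. Choose a linear form `l` regular modulo `I` and nonzero at every point of `Y(f)`.
Dividing by `l` as often as possible gives `a'` of degree `j ≤ m` with `a' * f₀ ∈ I` and `a' ∉ I +
(l)`. The quotient by `I + (l)` is an Artinian complete intersection whose socle sits in degree
`n(e-1)` (`socle_of_regularSeqMod`), so some form `b` of degree `D = n(e-1) - j` has `a' * b ∉ I +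
(l)`.

Let `N = ∑ o(m_p)` and `K = ∏ p ^ o(m_p)`, a product of ideals of points. A form of degree `D ≥ N`
is congruent modulo `K` to a multiple of `l ^ (D + 1 - N)`, hence of `l` (`separates_prod`). Locally
`K` lies in `J_f`, so a power of `l` sends each generator of `K` into `J_f`
(`exists_pow_mul_mem_J`). As `a' J_f ⊆ I` and `l` is regular modulo `I`, also `a' K ⊆ I`. Thus `a' *
b ∈ I + (l)`, a contradiction. -/

/-- `a` is a nonzerodivisor modulo the ideal `I`. -/
def RegularMod (I : Ideal (S n)) (a : S n) : Prop := ∀ u, a * u ∈ I → u ∈ I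

/-! ### Linear forms and homogeneous components -/

/-- The linear form with coefficient vector `w`. -/
def linForm : (Fin (n + 1) → ℂ) →ₗ[ℂ] S n := Fintype.linearCombination ℂ (X : Fin (n + 1) → S n)

theorem linForm_apply (w : Fin (n + 1) → ℂ) : linForm w = ∑ i, w i • (X i : S n) := by
  simp [linForm, Fintype.linearCombination_apply]

theorem linForm_single (i : Fin (n + 1)) : linForm (Pi.single i 1) = (X i : S n) := by
  simp [linForm]

theorem X_mem_grading (i : Fin (n + 1)) : (X i : S n) ∈ grading n 1 :=
  (mem_homogeneousSubmodule _ _).2 (isHomogeneous_X ℂ i)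

theorem linForm_mem (w : Fin (n + 1) → ℂ) : linForm w ∈ grading n 1 := by
  rw [linForm_apply]
  exact Submodule.sum_mem _ fun i _ => Submodule.smul_mem _ _ (X_mem_grading i)

theorem eval_linForm (v w : Fin (n + 1) → ℂ) : eval v (linForm w : S n) = w ⬝ᵥ v := by
  simp [linForm_apply, smul_eval, dotProduct]

theorem mem_of_forall_decompose {I : Ideal (S n)} {u : S n}
    (h : ∀ d, (decompose (grading n) u d : S n) ∈ I) : u ∈ I := by
  classical
  rw [← sum_support_decompose (grading n) u]
  exact Ideal.sum_mem _ fun d _ => h d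

theorem mul_mem_grading {a b : S n} {i j : ℕ} (ha : a ∈ grading n i) (hb : b ∈ grading n j) :
    a * b ∈ grading n (i + j) := SetLike.mul_mem_graded ha hb

theorem mem_or_exists_of_mem_sup_span {I : Ideal (S n)} (hI : I.IsHomogeneous (grading n))
    {a u : S n} {k d : ℕ} (ha : a ∈ grading n k) (hu : u ∈ grading n d)
    (h : u ∈ I ⊔ Ideal.span {a}) :
    u ∈ I ∨ (k ≤ d ∧ ∃ c ∈ grading n (d - k), u - a * c ∈ I) := by
  obtain ⟨i, hi, y, hy, rfl⟩ := Submodule.mem_sup.1 h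
  obtain ⟨c, rfl⟩ := Ideal.mem_span_singleton'.1 hy
  rw [mul_comm c a] at hu ⊢
  have key := decompose_of_mem_same (grading n) hu
  rw [decompose_add, DirectSum.add_apply, Submodule.coe_add] at key
  by_cases hk : k ≤ d
  · right
    refine ⟨hk, decompose (grading n) c (d - k), SetLike.coe_mem _, ?_⟩
    rw [coe_decompose_mul_of_left_mem_of_le (grading n) ha hk] at key
    rw [← key, add_sub_cancel_right]
    exact hI d hi
  · left
    rw [coe_decompose_mul_of_left_mem_of_not_le (grading n) ha hk, add_zero] at key
    rw [← key]
    exact hI d hi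

theorem mul_decompose_mem {I : Ideal (S n)} (hI : I.IsHomogeneous (grading n))
    {b u : S n} {k : ℕ} (hb : b ∈ grading n k) (h : b * u ∈ I) (d : ℕ) :
    b * (decompose (grading n) u d : S n) ∈ I := by
  have := hI (k + d) h
  rwa [coe_decompose_mul_add_of_left_mem (grading n) hb] at this

/-! ### Permuting homogeneous regular sequences -/

theorem RegularMod.of_homogeneous {I : Ideal (S n)} (hI : I.IsHomogeneous (grading n))
    {b : S n} {k : ℕ} (hb : b ∈ grading n k)
    (h : ∀ d, ∀ u ∈ grading n d, b * u ∈ I → u ∈ I) : RegularMod I b := fun _ hu =>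
  mem_of_forall_decompose fun d => h d _ (SetLike.coe_mem _) (mul_decompose_mem hI hb hu d)

/-- If `b * u ∈ I`, then `u ≡ a * c` modulo `I`, and cancelling `a` gives `b * c ∈ I`. As `a` has
positive degree, `c` has smaller degree than `u`, so induction on the degree plays the role of
Nakayama's lemma. -/
theorem RegularMod.swap_left {I : Ideal (S n)} (hI : I.IsHomogeneous (grading n))
    {a b : S n} {k l : ℕ} (hk : 0 < k) (ha : a ∈ grading n k) (hb : b ∈ grading n l)
    (h₁ : RegularMod I a) (h₂ : RegularMod (I ⊔ Ideal.span {a}) b) : RegularMod I b := by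
  refine RegularMod.of_homogeneous hI hb fun d => ?_
  induction d using Nat.strong_induction_on with
  | _ d ih =>
    intro u hu hbu
    rcases mem_or_exists_of_mem_sup_span hI ha hu (h₂ u (Ideal.mem_sup_left hbu)) with
      h | ⟨hkd, c, hc, huc⟩
    · exact h
    · have h3 : a * (b * c) ∈ I := by
        have : a * (b * c) = b * u - b * (u - a * c) := by ring
        rw [this]
        exact I.sub_mem hbu (I.mul_mem_left _ huc)
      have h4 := ih (d - k) (by omega) c hc (h₁ _ h3)
      have : u = (u - a * c) + a * c := by ring
      rw [this]
      exact I.add_mem huc (I.mul_mem_left _ h4)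

theorem RegularMod.swap_right {I : Ideal (S n)} {a b : S n}
    (h₁ : RegularMod I a) (h₂ : RegularMod (I ⊔ Ideal.span {a}) b) :
    RegularMod (I ⊔ Ideal.span {b}) a := by
  intro u hu
  obtain ⟨i, hi, y, hy, hiy⟩ := Submodule.mem_sup.1 hu
  obtain ⟨v, rfl⟩ := Ideal.mem_span_singleton'.1 hy
  have hv : v ∈ I ⊔ Ideal.span {a} := by
    apply h₂
    have : b * v = -i + a * u := by rw [← hiy]; ring
    rw [this]
    exact Ideal.add_mem _ (Ideal.mem_sup_left (I.neg_mem hi))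
      (Ideal.mem_sup_right (Ideal.mul_mem_right _ _ (Ideal.mem_span_singleton_self a)))
  obtain ⟨j, hj, z, hz, rfl⟩ := Submodule.mem_sup.1 hv
  obtain ⟨w, rfl⟩ := Ideal.mem_span_singleton'.1 hz
  have h3 : u - b * w ∈ I := by
    apply h₁
    have : a * (u - b * w) = i + b * j := by rw [mul_sub, ← hiy]; ring
    rw [this]
    exact I.add_mem hi (I.mul_mem_left _ hj)
  have : u = (u - b * w) + b * w := by ring
  rw [this]
  exact Ideal.add_mem _ (Ideal.mem_sup_left h3)
    (Ideal.mem_sup_right (Ideal.mul_mem_right _ _ (Ideal.mem_span_singleton_self b)))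

/-- The ideal generated by `I` and the first `t` terms of the sequence `g`. -/
def adjoinSeq (I : Ideal (S n)) (g : ℕ → S n) (t : ℕ) : Ideal (S n) :=
  I ⊔ Ideal.span (g '' Set.Iio t)

/-- The first `i` terms of `g` form a (weakly) regular sequence modulo `I`. -/
def RegularSeqMod (I : Ideal (S n)) (g : ℕ → S n) (i : ℕ) : Prop :=
  ∀ t < i, RegularMod (adjoinSeq I g t) (g t)

theorem adjoinSeq_zero (I : Ideal (S n)) (g : ℕ → S n) : adjoinSeq I g 0 = I := by
  simp [adjoinSeq]

theorem adjoinSeq_succ (I : Ideal (S n)) (g : ℕ → S n) (t : ℕ) :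
    adjoinSeq I g (t + 1) = adjoinSeq I g t ⊔ Ideal.span {g t} := by
  rw [adjoinSeq, adjoinSeq, sup_assoc, ← Ideal.span_union, ← Set.image_singleton,
    ← Set.image_union]
  congr 3
  ext x; simp [Order.lt_add_one_iff, le_iff_lt_or_eq, or_comm]

theorem adjoinSeq_sup (I I' : Ideal (S n)) (g : ℕ → S n) (t : ℕ) :
    adjoinSeq (I ⊔ I') g t = adjoinSeq I g t ⊔ I' := by
  rw [adjoinSeq, adjoinSeq, sup_assoc, sup_assoc, sup_comm I']

theorem isHomogeneous_adjoinSeq {I : Ideal (S n)} (hI : I.IsHomogeneous (grading n))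
    {g : ℕ → S n} {e : ℕ} (hg : ∀ t, g t ∈ grading n e) (t : ℕ) :
    (adjoinSeq I g t).IsHomogeneous (grading n) := by
  refine hI.sup (Ideal.homogeneous_span _ _ ?_)
  rintro _ ⟨s, -, rfl⟩
  exact ⟨e, hg s⟩

/-- A form regular after the whole sequence can be moved to its front, one transposition at a time.
-/
theorem RegularSeqMod.sup_span {I : Ideal (S n)} (hI : I.IsHomogeneous (grading n))
    {g : ℕ → S n} {e : ℕ} (he : 0 < e) (hg : ∀ t, g t ∈ grading n e)
    {l : S n} {k : ℕ} (hl : l ∈ grading n k) {i : ℕ} (h : RegularSeqMod I g i)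
    (hr : RegularMod (adjoinSeq I g i) l) : RegularSeqMod (I ⊔ Ideal.span {l}) g i := by
  induction i with
  | zero => intro t ht; omega
  | succ i ih =>
    rw [adjoinSeq_succ] at hr
    have h1 := h i (Nat.lt_succ_self i)
    have h2 := RegularMod.swap_left (isHomogeneous_adjoinSeq hI hg i) he (hg i) hl h1 hr
    have h3 := RegularMod.swap_right h1 hr
    have h4 := ih (fun t ht => h t (by omega)) h2
    intro t ht
    rcases Nat.lt_succ_iff_lt_or_eq.1 ht with ht | rfl
    · exact h4 t ht
    · rwa [adjoinSeq_sup]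

/-! ### Ideals generated by linear forms -/

/-- The ideal generated by the linear forms with coefficient vectors in `W`. -/
def linIdeal (W : Submodule ℂ (Fin (n + 1) → ℂ)) : Ideal (S n) :=
  Ideal.span (linForm '' (W : Set (Fin (n + 1) → ℂ)))

theorem linForm_mem_linIdeal {W : Submodule ℂ (Fin (n + 1) → ℂ)} {w : Fin (n + 1) → ℂ}
    (hw : w ∈ W) : linForm w ∈ linIdeal W := Ideal.subset_span ⟨w, hw, rfl⟩

theorem isHomogeneous_linIdeal (W : Submodule ℂ (Fin (n + 1) → ℂ)) :
    (linIdeal W).IsHomogeneous (grading n) :=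
  Ideal.homogeneous_span _ _ (by rintro _ ⟨w, -, rfl⟩; exact ⟨1, linForm_mem w⟩)

theorem linForm_injective : Function.Injective (linForm (n := n)) := by
  intro v w h
  funext i
  have := congrArg (eval (Pi.single i 1)) h
  simpa [eval_linForm] using this

/-- The map `φ` substitutes a linear projection `P` with kernel `W`. Its kernel is prime because `S`
is a domain, and it contains no linear forms beyond those of `W`. -/
theorem exists_algHom_ker_eq_linIdeal (W : Submodule ℂ (Fin (n + 1) → ℂ)) :
    ∃ φ : S n →ₐ[ℂ] S n, RingHom.ker φ = linIdeal W ∧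
      ∀ w, linForm w ∈ linIdeal W → w ∈ W := by
  obtain ⟨W', hW⟩ := Submodule.exists_isCompl W
  let P : (Fin (n + 1) → ℂ) →ₗ[ℂ] (Fin (n + 1) → ℂ) := W'.subtype ∘ₗ
    Submodule.projectionOnto W' W hW.symm
  have hP : ∀ w, P w = 0 ↔ w ∈ W := by
    intro w
    simp only [P, LinearMap.comp_apply, Submodule.subtype_apply, Submodule.coe_eq_zero]
    exact Submodule.projectionOnto_apply_eq_zero_iff hW.symm
  have hPP : ∀ w, P (P w) = P w := by
    intro w
    simp only [P, LinearMap.comp_apply, Submodule.subtype_apply]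
    rw [Submodule.projectionOnto_apply_left]
  let φ : S n →ₐ[ℂ] S n := aeval fun i => linForm (P (Pi.single i 1))
  have hφ : ∀ w, φ (linForm w) = linForm (P w) := by
    intro w
    have : (φ.toLinearMap ∘ₗ linForm) = linForm ∘ₗ P := by
      refine LinearMap.pi_ext' fun i => LinearMap.ext_ring ?_
      simp [linForm_single, φ]
    exact LinearMap.congr_fun this w
  have hle : linIdeal W ≤ RingHom.ker φ := by
    refine Ideal.span_le.2 ?_
    rintro _ ⟨w, hw, rfl⟩
    change φ _ = 0
    rw [hφ, (hP w).2 hw, map_zero]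
  refine ⟨φ, le_antisymm ?_ hle, fun w hw => ?_⟩
  -- Modulo `linIdeal W` the map `φ` is the identity, because `x - P x` lies in `W`; hence its
  -- kernel is no larger.
  · have hcomp : ((Ideal.Quotient.mkₐ ℂ (linIdeal W)).comp φ) =
        Ideal.Quotient.mkₐ ℂ (linIdeal W) := by
      refine MvPolynomial.algHom_ext fun i => ?_
      simp only [AlgHom.comp_apply, φ, aeval_X, Ideal.Quotient.mkₐ_eq_mk]
      rw [Ideal.Quotient.eq, ← linForm_single i, ← map_sub]
      apply linForm_mem_linIdeal
      rw [← hP, map_sub, hPP, sub_self]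
    intro u hu
    have h1 := AlgHom.congr_fun hcomp u
    rw [AlgHom.comp_apply, (show φ u = 0 from hu), map_zero] at h1
    exact Ideal.Quotient.eq_zero_iff_mem.1 h1.symm
  · have h1 : φ (linForm w) = 0 := hle hw
    rw [hφ] at h1
    exact (hP w).1 (linForm_injective (by rw [h1, map_zero]))

theorem linForm_mem_linIdeal_iff {W : Submodule ℂ (Fin (n + 1) → ℂ)} {w : Fin (n + 1) → ℂ} :
    linForm w ∈ linIdeal W ↔ w ∈ W :=
  ⟨(exists_algHom_ker_eq_linIdeal W).choose_spec.2 w, linForm_mem_linIdeal⟩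

instance isPrime_linIdeal (W : Submodule ℂ (Fin (n + 1) → ℂ)) : (linIdeal W).IsPrime := by
  obtain ⟨φ, h, -⟩ := exists_algHom_ker_eq_linIdeal W
  rw [← h]
  exact RingHom.ker_isPrime _

theorem linIdeal_sup_span (W : Submodule ℂ (Fin (n + 1) → ℂ)) (w : Fin (n + 1) → ℂ) :
    linIdeal W ⊔ Ideal.span {linForm w} = linIdeal (W ⊔ Submodule.span ℂ {w}) := by
  apply le_antisymm
  · refine sup_le (Ideal.span_mono (Set.image_mono ?_)) ?_
    · exact SetLike.coe_subset_coe.2 le_sup_left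
    · rw [Ideal.span_singleton_le_iff_mem]
      exact linForm_mem_linIdeal (Submodule.mem_sup_right (Submodule.mem_span_singleton_self w))
  · refine Ideal.span_le.2 ?_
    rintro _ ⟨x, hx, rfl⟩
    obtain ⟨y, hy, z, hz, rfl⟩ := Submodule.mem_sup.1 hx
    obtain ⟨c, rfl⟩ := Submodule.mem_span_singleton.1 hz
    rw [map_add, map_smul, smul_eq_C_mul]
    exact Ideal.add_mem _ (Ideal.mem_sup_left (linForm_mem_linIdeal hy))
      (Ideal.mem_sup_right (Ideal.mul_mem_left _ _ (Ideal.mem_span_singleton_self _)))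

theorem X_mem_linIdeal_top (i : Fin (n + 1)) : (X i : S n) ∈ linIdeal (⊤ : Submodule ℂ _) := by
  rw [← linForm_single]
  exact linForm_mem_linIdeal trivial

theorem mem_linIdeal_top_of_pos {d : ℕ} (hd : 0 < d) {u : S n} (hu : u ∈ grading n d) :
    u ∈ linIdeal (⊤ : Submodule ℂ _) := by
  rw [MvPolynomial.as_sum u]
  refine Ideal.sum_mem _ fun s hs => ?_
  have h1 : s.degree = d := by
    have := (mem_homogeneousSubmodule _ _).1 hu (MvPolynomial.mem_support_iff.1 hs)
    rw [← this, Finsupp.degree_eq_weight_one]; rfl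
  have h2 : s ≠ 0 := by rintro rfl; simp at h1; omega
  obtain ⟨i, hi⟩ := Finsupp.ne_iff.1 h2
  have : (X i : S n) ∣ monomial s (coeff s u) := by
    rw [X_dvd_monomial]; right; simpa using hi
  exact Ideal.mem_of_dvd _ this (X_mem_linIdeal_top i)

theorem adjoinSeq_linIdeal_le_top (W : Submodule ℂ (Fin (n + 1) → ℂ)) {g : ℕ → S n} {e : ℕ}
    (he : 0 < e) (hg : ∀ t, g t ∈ grading n e) (t : ℕ) :
    adjoinSeq (linIdeal W) g t ≤ linIdeal ⊤ := by
  refine sup_le (Ideal.span_mono (Set.image_mono (Set.subset_univ _))) (Ideal.span_le.2 ?_)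
  rintro _ ⟨s, -, rfl⟩
  exact mem_linIdeal_top_of_pos he (hg s)

/-! ### Prime avoidance by linear forms -/

/-- Over the infinite field `ℂ`, finitely many proper subspaces do not cover the space of linear
forms. -/
theorem exists_forall_linForm_notMem {T : Set (Ideal (S n))} (hT : T.Finite)
    (h : ∀ Q ∈ T, ¬ linIdeal ⊤ ≤ Q) : ∃ w, ∀ Q ∈ T, linForm w ∉ Q := by
  classical
  let s : Finset (Subspace ℂ (Fin (n + 1) → ℂ)) :=
    hT.toFinset.image fun Q => (Q.restrictScalars ℂ).comap linForm
  have hs : ⊤ ∉ s := by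
    intro htop
    obtain ⟨Q, hQ, hQt⟩ := Finset.mem_image.1 htop
    refine h Q (hT.mem_toFinset.1 hQ) (Ideal.span_le.2 ?_)
    rintro _ ⟨w, -, rfl⟩
    have : w ∈ (Q.restrictScalars ℂ).comap linForm := by rw [hQt]; trivial
    exact this
  have := Subspace.biUnion_ne_univ_of_top_notMem hs
  obtain ⟨w, hw⟩ := (Set.ne_univ_iff_exists_notMem _).1 this
  refine ⟨w, fun Q hQ hwQ => hw ?_⟩
  simp only [Set.mem_iUnion]
  exact ⟨_, Finset.mem_image_of_mem _ (hT.mem_toFinset.2 hQ), hwQ⟩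

/-- Prime avoidance: modulo an ideal whose quotient has no socle, some linear form is a
nonzerodivisor, and it can be chosen outside finitely many further ideals. -/
theorem exists_linForm_regularMod {K : Ideal (S n)}
    (hK : ∀ u, (∀ w, linForm w * u ∈ K) → u ∈ K) {T : Set (Ideal (S n))} (hT : T.Finite)
    (h : ∀ Q ∈ T, ¬ linIdeal ⊤ ≤ Q) :
    ∃ w, RegularMod K (linForm w) ∧ ∀ Q ∈ T, linForm w ∉ Q := by
  obtain ⟨w, hw⟩ := exists_forall_linForm_notMem
    (T := associatedPrimes (S n) (S n ⧸ K) ∪ T) ((associatedPrimes.finite _ _).union hT) (by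
      rintro Q (hQ | hQ)
      -- An associated prime containing all linear forms would be the annihilator of a socle
      -- element, which is zero by `hK`.
      · intro hle
        obtain ⟨hp, x, hx⟩ := isAssociatedPrime_iff.1 hQ
        obtain ⟨u, rfl⟩ := Ideal.Quotient.mk_surjective x
        apply hp.ne_top
        have huK : u ∈ K := by
          refine hK u fun w => ?_
          have := hle (linForm_mem_linIdeal (Submodule.mem_top (x := w)))
          rw [hx, Submodule.mem_colon_singleton] at this
          exact Ideal.Quotient.eq_zero_iff_mem.1 this
        rw [hx, Ideal.Quotient.eq_zero_iff_mem.2 huK, Ideal.eq_top_iff_one,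
          Submodule.mem_colon_singleton]
        simp
      · exact h Q hQ)
  refine ⟨w, fun u hu => ?_, fun Q hQ => hw Q (Or.inr hQ)⟩
  by_contra hne
  have : linForm w ∈ ⋃ p ∈ associatedPrimes (S n) (S n ⧸ K), (p : Set (S n)) := by
    rw [biUnion_associatedPrimes_eq_zero_divisors]
    refine ⟨Ideal.Quotient.mk K u, fun h0 => hne (Ideal.Quotient.eq_zero_iff_mem.1 h0), ?_⟩
    change Ideal.Quotient.mk K (linForm w * u) = 0
    exact Ideal.Quotient.eq_zero_iff_mem.2 hu
  simp only [Set.mem_iUnion] at this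
  obtain ⟨Q, hQ, hwQ⟩ := this
  exact hw Q (Or.inl hQ) hwQ

/-! ### Socles of complete intersections -/

theorem mem_sup_span_iff {K : Ideal (S n)} {a u : S n} :
    u ∈ K ⊔ Ideal.span {a} ↔ ∃ c, u - a * c ∈ K := by
  constructor
  · intro h
    obtain ⟨i, hi, y, hy, rfl⟩ := Submodule.mem_sup.1 h
    obtain ⟨c, rfl⟩ := Ideal.mem_span_singleton'.1 hy
    exact ⟨c, by rwa [mul_comm c a, add_sub_cancel_right]⟩
  · rintro ⟨c, hc⟩
    have : u = (u - a * c) + a * c := by ring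
    rw [this]
    exact Ideal.add_mem _ (Ideal.mem_sup_left hc)
      (Ideal.mem_sup_right (Ideal.mul_mem_right _ _ (Ideal.mem_span_singleton_self a)))

/-- A congruence `b * u ≡ a * v` modulo `K` transports socle elements `u` modulo `K + (a)` to socle
elements `v` modulo `K + (b)`. By `mem_sup_span_of_exchange`, nonzero classes stay nonzero. -/
theorem socle_exchange {K : Ideal (S n)} {a b u v y : S n} (ha : RegularMod K a)
    (huv : b * u - a * v ∈ K) (hu : y * u ∈ K ⊔ Ideal.span {a}) :
    y * v ∈ K ⊔ Ideal.span {b} := by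
  obtain ⟨c, hc⟩ := mem_sup_span_iff.1 hu
  refine mem_sup_span_iff.2 ⟨c, ha _ ?_⟩
  have : a * (y * v - b * c) = b * (y * u - a * c) - y * (b * u - a * v) := by ring
  rw [this]
  exact K.sub_mem (K.mul_mem_left _ hc) (K.mul_mem_left _ huv)

theorem mem_sup_span_of_exchange {K : Ideal (S n)} {a b u v : S n} (hb : RegularMod K b)
    (huv : b * u - a * v ∈ K) (hv : v ∈ K ⊔ Ideal.span {b}) : u ∈ K ⊔ Ideal.span {a} := by
  obtain ⟨c, hc⟩ := mem_sup_span_iff.1 hv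
  refine mem_sup_span_iff.2 ⟨c, hb _ ?_⟩
  have : b * (u - a * c) = (b * u - a * v) + a * (v - b * c) := by ring
  rw [this]
  exact K.add_mem huv (K.mul_mem_left _ hc)

/-- The socle of the quotient by a regular sequence of `i` forms of degree `e` and `j` linear
forms: it vanishes if `i + j ≤ n`, and it lives in degree `i * (e - 1)` if `i + j = n + 1`. -/
theorem socle_of_regularSeqMod {e : ℕ} (he : 0 < e) {g : ℕ → S n}
    (hg : ∀ t, g t ∈ grading n e) (i : ℕ) (W : Submodule ℂ (Fin (n + 1) → ℂ))
    (h : RegularSeqMod (linIdeal W) g i) :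
    (i + Module.finrank ℂ W ≤ n → ∀ u, (∀ w, linForm w * u ∈ adjoinSeq (linIdeal W) g i) →
      u ∈ adjoinSeq (linIdeal W) g i) ∧
    (i + Module.finrank ℂ W = n + 1 → ∀ d, d ≠ i * (e - 1) → ∀ u ∈ grading n d,
      (∀ w, linForm w * u ∈ adjoinSeq (linIdeal W) g i) → u ∈ adjoinSeq (linIdeal W) g i) := by
  induction i generalizing W with
  | zero =>
    rw [adjoinSeq_zero]
    constructor
    · intro hW u hu
      have hne : W ≠ ⊤ := by
        rintro rfl
        rw [finrank_top, Module.finrank_fin_fun] at hW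
        omega
      obtain ⟨w, hw⟩ := SetLike.exists_not_mem_of_ne_top W hne rfl
      exact ((isPrime_linIdeal W).mem_or_mem (hu w)).resolve_left
        fun h => hw (linForm_mem_linIdeal_iff.1 h)
    · intro hW d hd u hu _
      have : W = ⊤ := Submodule.eq_top_of_finrank_eq (by rw [Module.finrank_fin_fun]; omega)
      rw [this]
      exact mem_linIdeal_top_of_pos (by omega) hu
  | succ i ih =>
    have hi : RegularSeqMod (linIdeal W) g i := fun t ht => h t (by omega)
    have hreg := h i (Nat.lt_succ_self i)
    have hhom := isHomogeneous_adjoinSeq (isHomogeneous_linIdeal W) hg i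
    rw [adjoinSeq_succ]
    by_cases hn : i + Module.finrank ℂ W ≤ n
    swap
    · exact ⟨fun h => by omega, fun h => by omega⟩
    -- The quotient by the first `i` forms has no socle, so a regular linear form exists. It
    -- replaces the last form `g i`, which enlarges `W` by one dimension.
    obtain ⟨w, hw, -⟩ := exists_linForm_regularMod ((ih W hi).1 hn) Set.finite_empty (by simp)
    have hwW : w ∉ W := by
      intro hmem
      have h1 : (1 : S n) ∈ adjoinSeq (linIdeal W) g i :=
        hw 1 (by rw [mul_one]; exact Ideal.mem_sup_left (linForm_mem_linIdeal hmem))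
      exact (isPrime_linIdeal (⊤ : Submodule ℂ (Fin (n + 1) → ℂ))).ne_top
        ((Ideal.eq_top_iff_one _).2 (adjoinSeq_linIdeal_le_top W he hg i h1))
    have hfin : Module.finrank ℂ ↥(W ⊔ Submodule.span ℂ {w}) = Module.finrank ℂ W + 1 := by
      exact Submodule.finrank_sup_span_singleton hwW
    have hseq := RegularSeqMod.sup_span (isHomogeneous_linIdeal W) he hg (linForm_mem w) hi hw
    rw [linIdeal_sup_span] at hseq
    have ih' := ih _ hseq
    rw [hfin, ← linIdeal_sup_span, adjoinSeq_sup] at ih'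
    constructor
    · intro hle u hu
      obtain ⟨v, hv⟩ := mem_sup_span_iff.1 (hu w)
      exact mem_sup_span_of_exchange hw hv
        (ih'.1 (by omega) v fun y => socle_exchange hreg hv (hu y))
    · intro heq d hd u hu hsoc
      rcases mem_or_exists_of_mem_sup_span hhom (hg i)
        (mul_mem_grading (linForm_mem w) hu) (hsoc w) with h0 | ⟨hed, v, hv, huv⟩
      · exact Ideal.mem_sup_left (hw _ h0)
      · refine mem_sup_span_of_exchange hw huv
          (ih'.2 (by omega) _ ?_ v hv fun y => socle_exchange hreg huv (hsoc y))
        -- The transported element has degree `1 + d - e`, so trading `g i` for a linear form lowers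
        -- the socle degree by `e - 1`.
        intro hcontra
        apply hd
        rw [Nat.succ_mul]
        omega

/-- Multiplying into the socle: a form outside `K` of degree at most the socle degree has
a multiple in the socle degree outside `K`. -/
theorem exists_mul_notMem {K : Ideal (S n)} {s : ℕ}
    (hK : ∀ d, d ≠ s → ∀ u ∈ grading n d, (∀ w, linForm w * u ∈ K) → u ∈ K)
    {a : S n} {j : ℕ} (hj : j ≤ s) (ha : a ∈ grading n j) (haK : a ∉ K) :
    ∃ b ∈ grading n (s - j), a * b ∉ K := by
  obtain ⟨k, rfl⟩ := Nat.exists_eq_add_of_le hj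
  induction k generalizing j a with
  | zero => exact ⟨1, by simpa using SetLike.one_mem_graded (grading n), by simpa using haK⟩
  | succ k ih =>
    have : ∃ w, linForm w * a ∉ K := by
      by_contra! hcon
      exact haK (hK j (by omega) a ha hcon)
    obtain ⟨w, hw⟩ := this
    have hs : j + (k + 1) = 1 + j + k := by ring
    rw [hs] at hK ⊢
    obtain ⟨b, hb, hab⟩ := ih (mul_mem_grading (linForm_mem w) ha) hw hK (by omega)
    refine ⟨linForm w * b, ?_, by rwa [mul_left_comm, ← mul_assoc]⟩
    have := mul_mem_grading (linForm_mem w) hb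
    rwa [show 1 + (1 + j + k - (1 + j)) = 1 + j + k - j by omega] at this

/-- Descent along a nonzerodivisor `l` of degree one. -/
theorem exists_notMem_sup_span {I : Ideal (S n)} (hI : I.IsHomogeneous (grading n))
    {l a f : S n} (hl : l ∈ grading n 1) (hreg : RegularMod I l) {m : ℕ}
    (ha : a ∈ grading n m) (haI : a ∉ I) (haf : a * f ∈ I) :
    ∃ j ≤ m, ∃ a' ∈ grading n j, a' ∉ I ⊔ Ideal.span {l} ∧ a' * f ∈ I := by
  induction m using Nat.strong_induction_on generalizing a with
  | _ m ih =>
    -- If `a ≡ l * c` modulo `I`, regularity of `l` shows that `c` is again outside `I` with `c * f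
    -- ∈ I`, in degree one less.
    by_cases h : a ∈ I ⊔ Ideal.span {l}
    · rcases mem_or_exists_of_mem_sup_span hI hl ha h with h | ⟨hm, c, hc, hac⟩
      · exact absurd h haI
      · have hcI : c ∉ I := fun hcI => haI (by
          have : a = (a - l * c) + l * c := by ring
          rw [this]
          exact I.add_mem hac (I.mul_mem_left _ hcI))
        have hcf : c * f ∈ I := by
          apply hreg
          have : l * (c * f) = a * f - f * (a - l * c) := by ring
          rw [this]
          exact I.sub_mem haf (I.mul_mem_left _ hac)
        obtain ⟨j, hj, a', ha'⟩ := ih (m - 1) (by omega) hc hcI hcf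
        exact ⟨j, by omega, a', ha'⟩
    · exact ⟨m, le_rfl, a, ha, h, haf⟩

/-! ### Homogeneous ideals of points and the support of `Y(f)` -/

theorem aeval_smul_of_mem_grading {B : Type*} [CommRing B] [Algebra ℂ B] {k : ℕ} {u : S n}
    (hu : u ∈ grading n k) (v : Fin (n + 1) → ℂ) (t : B) :
    aeval (fun i => v i • t) u = eval v u • t ^ k := by
  rw [aeval_def, eval₂_eq', eval_eq', Finset.sum_smul]
  refine Finset.sum_congr rfl fun s hs => ?_
  have h1 : ∑ i, s i = k := by
    have := (mem_homogeneousSubmodule _ _).1 hu (MvPolynomial.mem_support_iff.1 hs)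
    rw [← this, Finsupp.weight_apply, Finsupp.sum_fintype _ _ (by simp)]
    simp
  simp_rw [smul_pow]
  rw [Finset.prod_smul, Finset.prod_pow_eq_pow_sum, h1, Algebra.smul_def, Algebra.smul_def,
    map_mul, mul_assoc]

/-- The coefficient vectors of the linear forms vanishing at `v`. -/
def annih (v : Fin (n + 1) → ℂ) : Submodule ℂ (Fin (n + 1) → ℂ) where
  carrier := {w | w ⬝ᵥ v = 0}
  add_mem' {a b} ha hb := by simp_all [add_dotProduct]
  zero_mem' := by simp
  smul_mem' c a ha := by simp_all [smul_dotProduct]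

theorem mem_annih {v w : Fin (n + 1) → ℂ} : w ∈ annih v ↔ w ⬝ᵥ v = 0 := Iff.rfl

/-- Modulo the linear forms vanishing at `v`, each `xᵢ` becomes `vᵢ t`, where `t` is the class of a
linear form with value `1` at `v`. A form `u` of degree `k` then becomes `u(v) t ^ k`. -/
theorem mem_linIdeal_annih_of_eval_eq_zero {v : Fin (n + 1) → ℂ} (hv : v ≠ 0) {k : ℕ} {u : S n}
    (hu : u ∈ grading n k) (h0 : eval v u = 0) : u ∈ linIdeal (annih v) := by
  obtain ⟨i, hi⟩ := Function.ne_iff.1 hv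
  let w₀ : Fin (n + 1) → ℂ := Pi.single i (v i)⁻¹
  have hw₀ : w₀ ⬝ᵥ v = 1 := by simp [w₀, inv_mul_cancel₀ hi]
  let t := Ideal.Quotient.mkₐ ℂ (linIdeal (annih v)) (linForm w₀)
  have h1 : (Ideal.Quotient.mkₐ ℂ (linIdeal (annih v))) = aeval fun i => v i • t := by
    refine MvPolynomial.algHom_ext fun j => ?_
    rw [aeval_X, ← map_smul, Ideal.Quotient.mkₐ_eq_mk, Ideal.Quotient.eq, ← linForm_single,
      ← map_smul, ← map_sub]
    apply linForm_mem_linIdeal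
    rw [mem_annih, sub_dotProduct, smul_dotProduct, hw₀]
    simp
  rw [← Ideal.Quotient.eq_zero_iff_mem, ← Ideal.Quotient.mkₐ_eq_mk ℂ, h1,
    aeval_smul_of_mem_grading hu, h0, zero_smul]

theorem exists_sub_mem_linIdeal_annih {v : Fin (n + 1) → ℂ} (hv : v ≠ 0) {l : S n}
    (hl : l ∈ grading n 1) (hlv : l ∉ linIdeal (annih v)) {k : ℕ} {b : S n}
    (hb : b ∈ grading n k) : ∃ c : ℂ, b - C c * l ^ k ∈ linIdeal (annih v) := by
  have h1 : eval v l ≠ 0 := fun h => hlv (mem_linIdeal_annih_of_eval_eq_zero hv hl h)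
  refine ⟨eval v b / eval v l ^ k, mem_linIdeal_annih_of_eval_eq_zero hv (k := k) ?_ ?_⟩
  · rw [← smul_eq_C_mul]
    have := SetLike.pow_mem_graded k hl
    rw [smul_eq_mul, mul_one] at this
    exact Submodule.sub_mem _ hb (Submodule.smul_mem _ _ this)
  · simp [div_mul_cancel₀ _ (pow_ne_zero k h1)]

theorem eq_of_le_of_not_isMaximal {R : Type*} [CommRing R] {J q p : Ideal R}
    (hdim : ringKrullDim (R ⧸ J) = 1) [hq : q.IsPrime] [hp : p.IsPrime] (hJq : J ≤ q)
    (hqp : q ≤ p) (hmax : ¬ p.IsMaximal) : q = p := by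
  have h1 : Ring.KrullDimLE 1 (R ⧸ J) := by
    rw [Ring.krullDimLE_iff, hdim]; simp
  have hker : ∀ {I : Ideal R}, J ≤ I →
      (I.map (Ideal.Quotient.mk J)).comap (Ideal.Quotient.mk J) = I := by
    intro I hI
    rw [Ideal.comap_map_of_surjective _ Ideal.Quotient.mk_surjective]
    simpa [← RingHom.ker_eq_comap_bot] using hI
  have hpp : (p.map (Ideal.Quotient.mk J)).IsPrime :=
    Ideal.map_isPrime_of_surjective Ideal.Quotient.mk_surjective (by simpa using hJq.trans hqp)
  have hqq : (q.map (Ideal.Quotient.mk J)).IsPrime :=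
    Ideal.map_isPrime_of_surjective Ideal.Quotient.mk_surjective (by simpa using hJq)
  rcases Ring.krullDimLE_one_iff.1 h1 _ hpp with hmin | hmx
  · have := hmin.2 ⟨hqq, bot_le⟩ (Ideal.map_mono hqp)
    have := Ideal.comap_mono (f := Ideal.Quotient.mk J) this
    rw [hker hJq, hker (hJq.trans hqp)] at this
    exact le_antisymm hqp this
  · refine absurd ?_ hmax
    rw [← hker (hJq.trans hqp)]
    exact Ideal.comap_isMaximal_of_surjective _ Ideal.Quotient.mk_surjective

theorem not_linIdeal_top_le (p : ProjectiveSpectrum (grading n)) :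
    ¬ linIdeal ⊤ ≤ p.asHomogeneousIdeal.toIdeal := by
  intro h
  apply p.not_irrelevant_le
  rw [← toIdeal_le_toIdeal_iff, HomogeneousIdeal.toIdeal_irrelevant_le]
  intro i hi x hx
  exact h (mem_linIdeal_top_of_pos hi hx)

/-- By the Nullstellensatz, a prime with no zero besides the origin would contain every linear form,
hence the irrelevant ideal. -/
theorem exists_zero_ne_zero (p : ProjectiveSpectrum (grading n)) :
    ∃ v : Fin (n + 1) → ℂ, v ≠ 0 ∧ ∀ u ∈ p.asHomogeneousIdeal.toIdeal, eval v u = 0 := by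
  by_contra! hcon
  apply not_linIdeal_top_le p
  refine Ideal.span_le.2 ?_
  rintro _ ⟨w, -, rfl⟩
  have h1 := vanishingIdeal_zeroLocus_eq_radical (k := ℂ) (K := ℂ) p.asHomogeneousIdeal.toIdeal
  rw [p.isPrime.radical] at h1
  rw [SetLike.mem_coe, ← h1, mem_vanishingIdeal_iff]
  intro x hx
  have hx0 : x = 0 := by
    by_contra hne
    obtain ⟨u, hu, hux⟩ := hcon x hne
    exact hux (by simpa [aeval_eq_eval] using hx u hu)
  rw [hx0, aeval_eq_eval]
  exact (eval_linForm _ _).trans (by simp)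

/-- The homogeneous ideal of a point of a projective scheme of dimension zero. -/
theorem exists_eq_linIdeal_annih {J : Ideal (S n)} (hdim : ringKrullDim (S n ⧸ J) = 1)
    {p : ProjectiveSpectrum (grading n)} (hp : J ≤ p.asHomogeneousIdeal.toIdeal) :
    ∃ v : Fin (n + 1) → ℂ, v ≠ 0 ∧ p.asHomogeneousIdeal.toIdeal = linIdeal (annih v) := by
  obtain ⟨v, hv, hpv⟩ := exists_zero_ne_zero p
  refine ⟨v, hv, ?_⟩
  -- The prime `p` lies in the ideal of the line through a zero `v`. That ideal is not maximal, so
  -- dimension one forces equality.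
  refine eq_of_le_of_not_isMaximal hdim hp ?_ ?_
  · intro u hu
    refine mem_of_forall_decompose fun d => ?_
    exact mem_linIdeal_annih_of_eval_eq_zero hv (SetLike.coe_mem _)
      (hpv _ (p.asHomogeneousIdeal.isHomogeneous d hu))
  · intro hmax
    have hle : linIdeal (annih v) ≤ linIdeal ⊤ :=
      Ideal.span_mono (Set.image_mono (Set.subset_univ _))
    have heq := hmax.eq_of_le (isPrime_linIdeal ⊤).ne_top hle
    obtain ⟨i, hi⟩ := Function.ne_iff.1 hv
    have h1 : (linForm (Pi.single i 1) : S n) ∈ linIdeal (annih v) := by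
      rw [heq]; exact linForm_mem_linIdeal trivial
    rw [linForm_mem_linIdeal_iff, mem_annih] at h1
    simp at h1
    exact hi h1

theorem mem_minimalPrimes_of_mem_zeroLocus {J : Ideal (S n)}
    (hdim : ringKrullDim (S n ⧸ J) = 1)
    {p : ProjectiveSpectrum (grading n)} (hp : J ≤ p.asHomogeneousIdeal.toIdeal) :
    p.asHomogeneousIdeal.toIdeal ∈ J.minimalPrimes := by
  refine ⟨⟨p.isPrime, hp⟩, fun q hq hqp => ?_⟩
  have := hq.1
  refine (eq_of_le_of_not_isMaximal hdim hq.2 hqp fun hmax => ?_).ge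
  obtain ⟨v, hv, hpv⟩ := exists_eq_linIdeal_annih hdim hp
  apply not_linIdeal_top_le p
  have hle : p.asHomogeneousIdeal.toIdeal ≤ linIdeal ⊤ := by
    rw [hpv]
    exact Ideal.span_mono (Set.image_mono (Set.subset_univ _))
  exact (hmax.eq_of_le (isPrime_linIdeal ⊤).ne_top hle).ge

theorem finite_support {f : Fin (n + 1) → S n} (hdim : ringKrullDim (S n ⧸ J f) = 1) :
    (support f).Finite := by
  refine Set.Finite.of_finite_image (f := fun p => p.asHomogeneousIdeal.toIdeal)
    (((J f).finite_minimalPrimes_of_isNoetherianRing (S n)).subset ?_) ?_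
  · rintro _ ⟨p, hp, rfl⟩
    exact mem_minimalPrimes_of_mem_zeroLocus hdim hp
  · intro p _ q _ h
    exact ProjectiveSpectrum.ext (HomogeneousIdeal.toIdeal_injective h)

/-! ### Forms modulo products of ideals of points -/

/-- `K` is generated by forms of degree `N`, and every form of degree `D ≥ N - 1` is divisible by
`l ^ (D + 1 - N)` modulo `K`. -/
def Separates (l : S n) (K : Ideal (S n)) (N : ℕ) : Prop :=
  (∃ H : Set (S n), H ⊆ grading n N ∧ K = Ideal.span H) ∧
    ∀ D, N ≤ D + 1 → ∀ b ∈ grading n D, ∃ c, l * c ∈ grading n N ∧ b - l ^ (D + 1 - N) * c ∈ K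

/-- For `N = 0` the quotient `c` would have degree `-1`. Stating its degree through `l * c` covers
this case with `c = 0`. -/
theorem separates_top (l : S n) : Separates l ⊤ 0 := by
  refine ⟨⟨{1}, ?_, by simp⟩, fun D _ b _ => ⟨0, by simp, trivial⟩⟩
  rintro _ rfl
  exact SetLike.one_mem_graded (grading n)

/-- For a generator `h`, the coefficient of degree `D - N` is a scalar times `l ^ (D - N)` modulo
the ideal of the point. The free multiplier `g` makes the claim stable under induction on the span.
-/
theorem exists_sub_mul_mem_mul {l : S n} {v : Fin (n + 1) → ℂ} (hv : v ≠ 0)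
    (hl : l ∈ grading n 1) (hlv : l ∉ linIdeal (annih v)) {N : ℕ} {H : Set (S n)}
    (hH : H ⊆ grading n N) {D : ℕ} (hD : N ≤ D) {r : S n} (hr : r ∈ Ideal.span H) (g : S n) :
    ∃ c ∈ grading n N, (decompose (grading n) (g * r) D : S n) - l ^ (D - N) * c ∈
      Ideal.span H * linIdeal (annih v) := by
  induction hr using Submodule.span_induction generalizing g with
  | mem h hh =>
    obtain ⟨c, hc⟩ := exists_sub_mem_linIdeal_annih hv hl hlv
      (SetLike.coe_mem (decompose (grading n) g (D - N)))
    refine ⟨C c * h, ?_, ?_⟩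
    · rw [← smul_eq_C_mul]
      exact Submodule.smul_mem _ _ (hH hh)
    · rw [coe_decompose_mul_of_right_mem_of_le (grading n) (hH hh) hD]
      have := Ideal.mul_mem_mul (Ideal.subset_span hh) hc
      convert this using 1
      ring
  | zero => exact ⟨0, Submodule.zero_mem _, by simp⟩
  | add x y _ _ hx hy =>
    obtain ⟨c, hc, hxc⟩ := hx g
    obtain ⟨d, hd, hyd⟩ := hy g
    refine ⟨c + d, Submodule.add_mem _ hc hd, ?_⟩
    rw [mul_add, decompose_add, DirectSum.add_apply, Submodule.coe_add]
    convert Ideal.add_mem _ hxc hyd using 1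
    ring
  | smul a x _ hx =>
    obtain ⟨c, hc, hxc⟩ := hx (g * a)
    refine ⟨c, hc, ?_⟩
    rwa [smul_eq_mul, ← mul_assoc]

open scoped Pointwise in
-- The remainder `r = b - l ^ (D + 1 - N) * c` lies in `K` and is `l ^ (D - N) * c'` modulo the new
-- product. The two quotients combine to `l * c + c'`, so each further factor costs one power of
-- `l`.
theorem Separates.mul_linIdeal {l : S n} {K : Ideal (S n)} {N : ℕ} (h : Separates l K N)
    (hl : l ∈ grading n 1) {v : Fin (n + 1) → ℂ} (hv : v ≠ 0) (hlv : l ∉ linIdeal (annih v)) :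
    Separates l (K * linIdeal (annih v)) (N + 1) := by
  obtain ⟨⟨H, hH, rfl⟩, hsep⟩ := h
  refine ⟨⟨H * (linForm '' (annih v : Set (Fin (n + 1) → ℂ))), ?_, ?_⟩, ?_⟩
  · rintro _ ⟨a, ha, _, ⟨w, -, rfl⟩, rfl⟩
    exact mul_mem_grading (hH ha) (linForm_mem w)
  · rw [linIdeal, Ideal.span_mul_span']
  · intro D hD b hb
    obtain ⟨c, hc, hbc⟩ := hsep D (by omega) b hb
    have hpow : l ^ (D + 1 - N) * c = l ^ (D - N) * (l * c) := by
      rw [show D + 1 - N = (D - N) + 1 by omega]; ring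
    have hr : b - l ^ (D + 1 - N) * c ∈ grading n D := by
      refine Submodule.sub_mem _ hb ?_
      rw [hpow]
      have := mul_mem_grading (SetLike.pow_mem_graded (D - N) hl) hc
      rwa [smul_eq_mul, mul_one, show D - N + N = D by omega] at this
    obtain ⟨c', hc', hrc⟩ := exists_sub_mul_mem_mul hv hl hlv hH (by omega : N ≤ D) hbc 1
    rw [one_mul, decompose_of_mem_same _ hr] at hrc
    refine ⟨l * c + c', ?_, ?_⟩
    · rw [add_comm N 1]
      exact mul_mem_grading hl (Submodule.add_mem _ hc hc')
    · convert hrc using 1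
      rw [hpow, show D + 1 - (N + 1) = D - N by omega]
      ring

theorem Separates.mul_linIdeal_pow {l : S n} {K : Ideal (S n)} {N : ℕ} (h : Separates l K N)
    (hl : l ∈ grading n 1) {v : Fin (n + 1) → ℂ} (hv : v ≠ 0) (hlv : l ∉ linIdeal (annih v))
    (k : ℕ) : Separates l (K * linIdeal (annih v) ^ k) (N + k) := by
  induction k with
  | zero => simpa using h
  | succ k ih =>
    rw [pow_succ, ← mul_assoc, ← add_assoc]
    exact ih.mul_linIdeal hl hv hlv

theorem separates_prod {ι : Type*} (s : Finset ι) (P : ι → Ideal (S n)) (o : ι → ℕ) {l : S n}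
    (hl : l ∈ grading n 1)
    (hP : ∀ i, ∃ v : Fin (n + 1) → ℂ, v ≠ 0 ∧ P i = linIdeal (annih v)) (hlP : ∀ i, l ∉ P i) :
    Separates l (∏ i ∈ s, P i ^ o i) (∑ i ∈ s, o i) := by
  classical
  induction s using Finset.induction_on with
  | empty => simpa using separates_top l
  | insert i s hi ih =>
    obtain ⟨v, hv, hPv⟩ := hP i
    rw [Finset.prod_insert hi, Finset.sum_insert hi, mul_comm, add_comm (o i), hPv]
    exact ih.mul_linIdeal_pow hl hv (hPv ▸ hlP i) _

/-! ### Local rings of `Y(f)` -/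

/-- Nilpotency makes the maximal ideal the only prime, so Cohen's theorem gives Noetherianity from
its finite generation. -/
theorem isArtinianRing_of_fg_of_pow_eq_bot {R : Type*} [CommRing R] [IsLocalRing R]
    (hfg : (maximalIdeal R).FG) {k : ℕ} (hk : maximalIdeal R ^ k = ⊥) : IsArtinianRing R := by
  have hN : IsNoetherianRing R := by
    refine IsNoetherianRing.of_prime fun q hq => ?_
    have h1 : maximalIdeal R ≤ q := hq.le_of_pow_le (n := k) (by rw [hk]; exact bot_le)
    rwa [← (maximalIdeal.isMaximal R).eq_of_le hq.ne_top h1]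
  exact (isArtinianRing_iff_isNilpotent_maximalIdeal R).2 ⟨k, hk⟩

theorem maximalIdeal_quotient_eq_map {R : Type*} [CommRing R] [IsLocalRing R] (I : Ideal R)
    [IsLocalRing (R ⧸ I)] :
    maximalIdeal (R ⧸ I) = (maximalIdeal R).map (Ideal.Quotient.mk I) := by
  apply le_antisymm
  · intro y hy
    obtain ⟨x, rfl⟩ := Ideal.Quotient.mk_surjective y
    refine Ideal.mem_map_of_mem _ ((mem_maximalIdeal _).2 fun hx => ?_)
    exact (mem_maximalIdeal _).1 hy (hx.map _)
  · have hI : I ≠ ⊤ := Ideal.Quotient.nontrivial_iff.1 inferInstance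
    refine Ideal.map_le_iff_le_comap.2 fun x hx => (mem_maximalIdeal _).2 fun hu => ?_
    obtain ⟨y, hy⟩ := hu.exists_right_inv
    obtain ⟨z, rfl⟩ := Ideal.Quotient.mk_surjective y
    rw [← map_mul, ← map_one (Ideal.Quotient.mk I), Ideal.Quotient.eq] at hy
    refine (maximalIdeal.isMaximal R).ne_top ((Ideal.eq_top_iff_one _).2 ?_)
    have := Ideal.sub_mem _ (Ideal.mul_mem_right z _ hx) (le_maximalIdeal hI hy)
    rwa [sub_sub_cancel] at this

section Stalk

variable (p : ProjectiveSpectrum (grading n))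

/-- The fraction `a / s` of two forms of the same degree in the local ring of `ℙⁿ` at `p`. -/
def frac {d : ℕ} {a s : S n} (ha : a ∈ grading n d) (hs : s ∈ grading n d)
    (hsp : s ∉ p.asHomogeneousIdeal.toIdeal) : ambientLocalRing p :=
  HomogeneousLocalization.mk ⟨d, ⟨a, ha⟩, ⟨s, hs⟩, hsp⟩

/-- The localization map to the full local ring of `S` at the prime `p`. -/
abbrev toLoc : S n →+* Localization.AtPrime p.asHomogeneousIdeal.toIdeal :=
  algebraMap (S n) (Localization.AtPrime p.asHomogeneousIdeal.toIdeal)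

variable {p}

theorem isUnit_toLoc {s : S n} (hsp : s ∉ p.asHomogeneousIdeal.toIdeal) : IsUnit (toLoc p s) :=
  IsLocalization.map_units (M := p.asHomogeneousIdeal.toIdeal.primeCompl) _ ⟨s, hsp⟩

theorem val_frac_mul {d : ℕ} {a s : S n} (ha : a ∈ grading n d) (hs : s ∈ grading n d)
    (hsp : s ∉ p.asHomogeneousIdeal.toIdeal) :
    (frac p ha hs hsp).val * toLoc p s = toLoc p a := by
  rw [frac, HomogeneousLocalization.val_mk, Localization.mk_eq_mk']
  exact IsLocalization.mk'_spec _ a (⟨s, hsp⟩ : p.asHomogeneousIdeal.toIdeal.primeCompl)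

theorem exists_val_mul_eq (x : ambientLocalRing p) :
    ∃ d, ∃ a ∈ grading n d, ∃ s ∈ grading n d, s ∉ p.asHomogeneousIdeal.toIdeal ∧
      x.val * toLoc p s = toLoc p a := by
  obtain ⟨⟨d, ⟨a, ha⟩, ⟨s, hs⟩, hsp⟩, rfl⟩ := HomogeneousLocalization.mk_surjective x
  exact ⟨d, a, ha, s, hs, hsp, val_frac_mul ha hs hsp⟩

theorem val_mem_maximalIdeal {x : ambientLocalRing p} :
    x.val ∈ maximalIdeal (Localization.AtPrime p.asHomogeneousIdeal.toIdeal) ↔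
      x ∈ maximalIdeal (ambientLocalRing p) := by
  rw [mem_maximalIdeal, mem_maximalIdeal, mem_nonunits_iff, mem_nonunits_iff,
    HomogeneousLocalization.isUnit_iff_isUnit_val]

theorem toLoc_mem_maximalIdeal {a : S n} :
    toLoc p a ∈ maximalIdeal (Localization.AtPrime p.asHomogeneousIdeal.toIdeal) ↔
      a ∈ p.asHomogeneousIdeal.toIdeal :=
  IsLocalization.AtPrime.to_map_mem_maximal_iff _ p.asHomogeneousIdeal.toIdeal a

theorem mem_of_mem_maximalIdeal {x : ambientLocalRing p}
    (hx : x ∈ maximalIdeal (ambientLocalRing p)) {a s : S n}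
    (h : x.val * toLoc p s = toLoc p a) : a ∈ p.asHomogeneousIdeal.toIdeal := by
  rw [← toLoc_mem_maximalIdeal, ← h]
  exact Ideal.mul_mem_right _ _ (val_mem_maximalIdeal.2 hx)

theorem frac_mem_maximalIdeal {d : ℕ} {a s : S n} (ha : a ∈ grading n d) (hs : s ∈ grading n d)
    (hsp : s ∉ p.asHomogeneousIdeal.toIdeal) (hap : a ∈ p.asHomogeneousIdeal.toIdeal) :
    frac p ha hs hsp ∈ maximalIdeal (ambientLocalRing p) := by
  rw [← val_mem_maximalIdeal, ← Ideal.mul_unit_mem_iff_mem _ (isUnit_toLoc hsp), val_frac_mul]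
  exact toLoc_mem_maximalIdeal.2 hap

theorem exists_linForm_notMem (p : ProjectiveSpectrum (grading n)) :
    ∃ w, linForm w ∉ p.asHomogeneousIdeal.toIdeal := by
  obtain ⟨w, hw⟩ := exists_forall_linForm_notMem (Set.finite_singleton p.asHomogeneousIdeal.toIdeal)
    (by rintro _ rfl; exact not_linIdeal_top_le p)
  exact ⟨w, hw _ rfl⟩

/-- The key identity is `(y * w) / s = (w / l) * (y * l / s)` for linear `w`. The multiplier `a` and
the passage to the component of degree `D` let the induction on the span go through with
inhomogeneous coefficients. -/
theorem mem_span_frac {l : S n} (hl : l ∈ grading n 1) (hlp : l ∉ p.asHomogeneousIdeal.toIdeal)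
    {B : Set (Fin (n + 1) → ℂ)} {g : S n} (hg : g ∈ Ideal.span (linForm '' B)) (a : S n) {D : ℕ}
    {s : S n} (hs : s ∈ grading n D) (hsp : s ∉ p.asHomogeneousIdeal.toIdeal)
    {x : ambientLocalRing p}
    (hx : x.val * toLoc p s = toLoc p (decompose (grading n) (a * g) D : S n)) :
    x ∈ Ideal.span ((fun w => frac p (linForm_mem w) hl hlp) '' B) := by
  induction hg using Submodule.span_induction generalizing a x with
  | mem h hh =>
    obtain ⟨w, hw, rfl⟩ := hh
    by_cases hD : 1 ≤ D
    · rw [coe_decompose_mul_of_right_mem_of_le (grading n) (linForm_mem w) hD] at hx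
      have hy : (decompose (grading n) a (D - 1) : S n) * l ∈ grading n D := by
        have := mul_mem_grading (SetLike.coe_mem (decompose (grading n) a (D - 1))) hl
        rwa [Nat.sub_add_cancel hD] at this
      have hxy : x = frac p (linForm_mem w) hl hlp * frac p hy hs hsp := by
        rw [HomogeneousLocalization.ext_iff_val, HomogeneousLocalization.val_mul]
        apply (isUnit_toLoc hsp).mul_right_cancel
        apply (isUnit_toLoc hlp).mul_right_cancel
        have h1 := val_frac_mul (linForm_mem w) hl hlp
        have h2 := val_frac_mul hy hs hsp
        rw [hx, mul_assoc _ _ (toLoc p s), h2, mul_right_comm, h1, map_mul, map_mul]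
        ring
      rw [hxy]
      exact Ideal.mul_mem_right _ _ (Ideal.subset_span ⟨w, hw, rfl⟩)
    · rw [coe_decompose_mul_of_right_mem_of_not_le (grading n) (linForm_mem w) hD, map_zero] at hx
      have : x = 0 := by
        rw [HomogeneousLocalization.ext_iff_val, HomogeneousLocalization.val_zero]
        exact (isUnit_toLoc hsp).mul_left_eq_zero.1 hx
      rw [this]
      exact Ideal.zero_mem _
  | zero =>
    have : x = 0 := by
      rw [HomogeneousLocalization.ext_iff_val, HomogeneousLocalization.val_zero]
      exact (isUnit_toLoc hsp).mul_left_eq_zero.1 (by simpa using hx)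
    rw [this]
    exact Ideal.zero_mem _
  | add y z _ _ hy hz =>
    have h1 := val_frac_mul (SetLike.coe_mem (decompose (grading n) (a * y) D)) hs hsp
    set x' := frac p (SetLike.coe_mem (decompose (grading n) (a * y) D)) hs hsp
    have h2 : (x - x').val * toLoc p s = toLoc p (decompose (grading n) (a * z) D : S n) := by
      rw [HomogeneousLocalization.val_sub, sub_mul, hx, h1, mul_add, decompose_add,
        DirectSum.add_apply, Submodule.coe_add, map_add, add_sub_cancel_left]
    have := Ideal.add_mem _ (hy a h1) (hz a h2)
    rwa [add_sub_cancel] at this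
  | smul b y _ hy =>
    refine hy (a * b) ?_
    rwa [mul_assoc]

theorem fg_maximalIdeal {W : Submodule ℂ (Fin (n + 1) → ℂ)}
    (hW : p.asHomogeneousIdeal.toIdeal = linIdeal W) :
    (maximalIdeal (ambientLocalRing p)).FG := by
  obtain ⟨B, hB⟩ := (IsNoetherian.noetherian W : W.FG)
  obtain ⟨w₀, hw₀⟩ := exists_linForm_notMem p
  have hspan : linIdeal W = Ideal.span (linForm '' (B : Set (Fin (n + 1) → ℂ))) := by
    refine le_antisymm (Ideal.span_le.2 ?_) (Ideal.span_mono (Set.image_mono ?_))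
    · rintro _ ⟨w, hw, rfl⟩
      rw [← hB] at hw
      induction hw using Submodule.span_induction with
      | mem w hw => exact Ideal.subset_span ⟨w, hw, rfl⟩
      | zero => simp
      | add x y _ _ hx hy => rw [map_add]; exact Ideal.add_mem _ hx hy
      | smul c x _ hx => rw [map_smul, smul_eq_C_mul]; exact Ideal.mul_mem_left _ _ hx
    · rw [← hB]; exact Submodule.subset_span
  have heq : maximalIdeal (ambientLocalRing p) =
      Ideal.span ((fun w => frac p (linForm_mem w) (linForm_mem w₀) hw₀) '' (B : Set _)) := by
    apply le_antisymm
    · intro x hx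
      obtain ⟨d, a, ha, s, hs, hsp, hxs⟩ := exists_val_mul_eq x
      have hap := mem_of_mem_maximalIdeal hx hxs
      rw [hW, hspan] at hap
      refine mem_span_frac (linForm_mem w₀) hw₀ hap 1 hs hsp ?_
      rw [one_mul, decompose_of_mem_same _ ha, hxs]
    · refine Ideal.span_le.2 ?_
      rintro _ ⟨w, hw, rfl⟩
      refine frac_mem_maximalIdeal _ _ _ ?_
      rw [hW, hspan]
      exact Ideal.subset_span ⟨w, hw, rfl⟩
  rw [heq]
  exact Submodule.fg_span (B.finite_toSet.image _)

/-- At a minimal prime of `J_f`, the extended ideal in the Noetherian ring `S_p` has the maximal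
ideal as radical, so it contains a power of it. This is then contracted to degree zero. -/
theorem pow_maximalIdeal_le_idealStalk {f : Fin (n + 1) → S n}
    (hmin : p.asHomogeneousIdeal.toIdeal ∈ (J f).minimalPrimes) :
    ∃ k, maximalIdeal (ambientLocalRing p) ^ k ≤ idealStalk f p := by
  have h1 := IsLocalization.AtPrime.radical_map_of_mem_minimalPrimes
    (A := Localization.AtPrime p.asHomogeneousIdeal.toIdeal) p.asHomogeneousIdeal.toIdeal (J f) hmin
  rw [Localization.AtPrime.map_eq_maximalIdeal] at h1
  have : IsNoetherianRing (Localization.AtPrime p.asHomogeneousIdeal.toIdeal) :=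
    IsLocalization.isNoetherianRing p.asHomogeneousIdeal.toIdeal.primeCompl _ inferInstance
  obtain ⟨k, hk⟩ := Ideal.exists_pow_le_of_le_radical_of_fg h1.ge (IsNoetherian.noetherian _)
  refine ⟨k, ?_⟩
  rw [idealStalk, ← Ideal.map_le_iff_le_comap, Ideal.map_pow]
  refine le_trans (Ideal.pow_right_mono ?_ k) hk
  rw [Ideal.map_le_iff_le_comap]
  intro x hx
  exact val_mem_maximalIdeal.2 hx

/-- Writing `w = (w / w₀) * w₀` shows that `p S_p` is generated by degree zero fractions in the
maximal ideal, so the containment passes from degree zero to `S_p`. -/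
theorem map_pow_le_of_pow_maximalIdeal_le {f : Fin (n + 1) → S n}
    {W : Submodule ℂ (Fin (n + 1) → ℂ)} (hW : p.asHomogeneousIdeal.toIdeal = linIdeal W) {k : ℕ}
    (hk : maximalIdeal (ambientLocalRing p) ^ k ≤ idealStalk f p) :
    (p.asHomogeneousIdeal.toIdeal ^ k).map (toLoc p) ≤ (J f).map (toLoc p) := by
  rw [idealStalk, ← Ideal.map_le_iff_le_comap, Ideal.map_pow] at hk
  rw [Ideal.map_pow]
  refine le_trans (Ideal.pow_right_mono ?_ k) hk
  obtain ⟨w₀, hw₀⟩ := exists_linForm_notMem p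
  refine Ideal.map_le_iff_le_comap.2 (hW.le.trans (Ideal.span_le.2 ?_))
  rintro _ ⟨w, hw, rfl⟩
  rw [SetLike.mem_coe, Ideal.mem_comap, ← val_frac_mul (linForm_mem w) (linForm_mem w₀) hw₀]
  rw [← HomogeneousLocalization.algebraMap_apply]
  refine Ideal.mul_mem_right _ _ (Ideal.mem_map_of_mem _ ?_)
  refine frac_mem_maximalIdeal _ _ _ ?_
  rw [hW]
  exact linForm_mem_linIdeal hw

end Stalk

section LocalRing

variable {f : Fin (n + 1) → S n}

theorem exists_pow_maximalIdeal_eq_bot (hdim : ringKrullDim (S n ⧸ J f) = 1) (p : support f) :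
    ∃ k, maximalIdeal (localRing f p) ^ k = ⊥ := by
  obtain ⟨k, hk⟩ := pow_maximalIdeal_le_idealStalk (mem_minimalPrimes_of_mem_zeroLocus hdim p.2)
  refine ⟨k, ?_⟩
  rw [maximalIdeal_quotient_eq_map, ← Ideal.map_pow, Ideal.map_eq_bot_iff_le_ker, Ideal.mk_ker]
  exact hk

theorem isArtinianRing_localRing (hdim : ringKrullDim (S n ⧸ J f) = 1) (p : support f) :
    IsArtinianRing (localRing f p) := by
  obtain ⟨k, hk⟩ := exists_pow_maximalIdeal_eq_bot hdim p
  obtain ⟨v, -, hv⟩ := exists_eq_linIdeal_annih hdim p.2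
  refine isArtinianRing_of_fg_of_pow_eq_bot ?_ hk
  rw [maximalIdeal_quotient_eq_map]
  exact (fg_maximalIdeal hv).map _

theorem pow_order_eq_bot (hdim : ringKrullDim (S n ⧸ J f) = 1) (p : support f) :
    maximalIdeal (localRing f p) ^ order f p = ⊥ := by
  obtain ⟨k, hk⟩ := exists_pow_maximalIdeal_eq_bot hdim p
  have : order f p ∈ {k | 0 < k ∧ maximalIdeal (localRing f p) ^ k = ⊥} :=
    Nat.sInf_mem ⟨k + 1, Nat.succ_pos k, by rw [pow_succ, hk, Ideal.bot_mul]⟩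
  exact this.2

theorem exists_mul_mem_of_mem_pow_order (hdim : ringKrullDim (S n ⧸ J f) = 1) (p : support f)
    {g : S n} (hg : g ∈ p.1.asHomogeneousIdeal.toIdeal ^ order f p) :
    ∃ s, s ∉ p.1.asHomogeneousIdeal.toIdeal ∧ s * g ∈ J f := by
  obtain ⟨v, -, hv⟩ := exists_eq_linIdeal_annih hdim p.2
  have h1 : maximalIdeal (ambientLocalRing p.1) ^ order f p ≤ idealStalk f p.1 := by
    have := pow_order_eq_bot hdim p
    rwa [maximalIdeal_quotient_eq_map, ← Ideal.map_pow, Ideal.map_eq_bot_iff_le_ker,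
      Ideal.mk_ker] at this
  have h2 := map_pow_le_of_pow_maximalIdeal_le hv h1 (Ideal.mem_map_of_mem _ hg)
  rw [IsLocalization.algebraMap_mem_map_algebraMap_iff
    p.1.asHomogeneousIdeal.toIdeal.primeCompl] at h2
  obtain ⟨s, hs, hsg⟩ := h2
  exact ⟨s, hs, hsg⟩

/-- A homogeneous prime over `(J_f : g)` that misses `l` would be a point of the support, but there
`(J_f : g)` has an element `s` outside the prime. Hence `l` lies in the radical of `(J_f : g)`. -/
theorem exists_pow_mul_mem_J {e : ℕ} (hf : ∀ j, f j ∈ grading n e) {l : S n} {k : ℕ}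
    (hk : l ∈ grading n k) (hkpos : 0 < k) {d : ℕ} {g : S n} (hg : g ∈ grading n d)
    (h : ∀ p : support f, ∃ s, s ∉ p.1.asHomogeneousIdeal.toIdeal ∧ s * g ∈ J f) :
    ∃ M, l ^ M * g ∈ J f := by
  have hJ : (J f).IsHomogeneous (grading n) :=
    Ideal.homogeneous_span _ _ (by rintro _ ⟨j, rfl⟩; exact ⟨e, hf j⟩)
  have hcol : ((J f).colon {g}).IsHomogeneous (grading n) := by
    intro i x hx
    rw [Submodule.mem_colon_singleton, smul_eq_mul, mul_comm] at hx ⊢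
    exact mul_decompose_mem hJ hg hx i
  have hrad : l ∈ ((J f).colon {g}).radical := by
    rw [hcol.radical_eq, Ideal.mem_sInf]
    rintro Q ⟨hQ, hle, hprime⟩
    by_contra hlQ
    let p : ProjectiveSpectrum (grading n) := ⟨⟨Q, hQ⟩, hprime, fun hirr =>
      hlQ (hirr (HomogeneousIdeal.mem_irrelevant_of_mem (grading n) hkpos hk))⟩
    have hp : p ∈ support f := by
      intro x hx
      refine hle ?_
      rw [Submodule.mem_colon_singleton]
      exact Ideal.mul_mem_right _ _ hx
    obtain ⟨s, hs, hsg⟩ := h ⟨p, hp⟩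
    exact hs (hle (Submodule.mem_colon_singleton.2 hsg))
  obtain ⟨M, hM⟩ := hrad
  exact ⟨M, by simpa [Submodule.mem_colon_singleton] using hM⟩

end LocalRing

/-! ### The annihilator of `f₀` modulo `(f₁, …, fₙ)` -/

/-- The forms in the order `f₁, …, fₙ, f₀`, continued periodically. -/
def cyc (f : Fin (n + 1) → S n) (t : ℕ) : S n := f (Fin.ofNat (n + 1) (t + 1))

theorem cyc_of_lt (f : Fin (n + 1) → S n) {t : ℕ} (ht : t < n) :
    cyc f t = f (Fin.succ ⟨t, ht⟩) := by
  rw [cyc]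
  congr 1
  ext
  simp [Fin.ofNat, Nat.mod_eq_of_lt (show t + 1 < n + 1 by omega)]

theorem linIdeal_bot : linIdeal (⊥ : Submodule ℂ (Fin (n + 1) → ℂ)) = ⊥ := by
  simp [linIdeal]

theorem ofList_take_eq (f : Fin (n + 1) → S n) {t : ℕ} (ht : t ≤ n) :
    Ideal.ofList ((List.ofFn fun i : Fin n => f i.succ).take t) = adjoinSeq ⊥ (cyc f) t := by
  rw [Ideal.ofList, adjoinSeq, bot_sup_eq]
  congr 1
  ext x
  simp only [Set.mem_ofPred_eq, Set.mem_image, Set.mem_Iio, List.mem_take_iff_getElem,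
    List.length_ofFn, List.getElem_ofFn]
  constructor
  · rintro ⟨i, hi, rfl⟩
    exact ⟨i, by omega, cyc_of_lt f (by omega)⟩
  · rintro ⟨i, hi, rfl⟩
    exact ⟨i, by omega, (cyc_of_lt f (by omega)).symm⟩

theorem regularSeqMod_cyc {f : Fin (n + 1) → S n}
    (h : RingTheory.Sequence.IsRegular (S n) (List.ofFn fun i : Fin n => f i.succ)) :
    RegularSeqMod ⊥ (cyc f) n := by
  intro t ht u hu
  have h1 := h.1.regular_mod_prev t (by simpa using ht)
  rw [ofList_take_eq f ht.le] at h1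
  have h2 : (adjoinSeq ⊥ (cyc f) t • ⊤ : Submodule (S n) (S n)) = adjoinSeq ⊥ (cyc f) t := by
    rw [smul_eq_mul, Ideal.mul_top]
  rw [h2, List.getElem_ofFn, ← cyc_of_lt f ht] at h1
  have h3 : cyc f t • (Ideal.Quotient.mk (adjoinSeq ⊥ (cyc f) t) u) =
      cyc f t • (0 : S n ⧸ adjoinSeq ⊥ (cyc f) t) := by
    rw [smul_zero]
    exact Ideal.Quotient.eq_zero_iff_mem.2 hu
  exact Ideal.Quotient.eq_zero_iff_mem.1 (h1 h3)

theorem J_le_sup (f : Fin (n + 1) → S n) : J f ≤ adjoinSeq ⊥ (cyc f) n ⊔ Ideal.span {f 0} := by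
  refine Ideal.span_le.2 ?_
  rintro _ ⟨j, rfl⟩
  refine Fin.cases ?_ (fun i => ?_) j
  · exact Ideal.mem_sup_right (Ideal.mem_span_singleton_self _)
  · refine Ideal.mem_sup_left (Ideal.mem_sup_right (Ideal.subset_span ⟨i, i.2, ?_⟩))
    exact cyc_of_lt f i.2

/-- The annihilator of `f₀` modulo `(f₁, …, fₙ)` vanishes in low degrees. -/
theorem mem_adjoinSeq_of_mul_mem {e : ℕ} (he : 0 < e) {f : Fin (n + 1) → S n}
    (hf : ∀ j, f j ∈ grading n e) (hJ : IsOneDimCI f) {m : ℕ}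
    (hm : m + ∑ᶠ p : support f, order f p ≤ n * (e - 1)) {a : S n} (ha : a ∈ grading n m)
    (haf : a * f 0 ∈ adjoinSeq ⊥ (cyc f) n) : a ∈ adjoinSeq ⊥ (cyc f) n := by
  by_contra haI
  obtain ⟨hdim, hreg⟩ := hJ
  have hfin := finite_support hdim
  have : Fintype (support f) := hfin.fintype
  rw [finsum_eq_sum_of_fintype] at hm
  have hg : ∀ t, cyc f t ∈ grading n e := fun t => hf _
  have hseq := regularSeqMod_cyc hreg
  set I := adjoinSeq ⊥ (cyc f) n with hI
  have hIhom : I.IsHomogeneous (grading n) :=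
    isHomogeneous_adjoinSeq (Ideal.IsHomogeneous.bot _) hg n
  have hsocA := (socle_of_regularSeqMod he hg n ⊥ (by rwa [linIdeal_bot])).1 (by simp)
  rw [linIdeal_bot, ← hI] at hsocA
  obtain ⟨w, hw, hwp⟩ := exists_linForm_regularMod hsocA
    (T := (fun p : ProjectiveSpectrum (grading n) => p.asHomogeneousIdeal.toIdeal) '' support f)
    (hfin.image _) (by rintro _ ⟨p, -, rfl⟩; exact not_linIdeal_top_le p)
  have hw0 : w ≠ 0 := by
    rintro rfl
    apply haI
    apply hw
    rw [map_zero, zero_mul]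
    exact I.zero_mem
  have hseqB := RegularSeqMod.sup_span (Ideal.IsHomogeneous.bot _) he hg (linForm_mem w) hseq hw
  rw [← linIdeal_bot, linIdeal_sup_span, bot_sup_eq] at hseqB
  have hsocB := (socle_of_regularSeqMod he hg n _ hseqB).2 (by rw [finrank_span_singleton hw0])
  have hB : adjoinSeq (linIdeal (Submodule.span ℂ {w})) (cyc f) n =
      I ⊔ Ideal.span {linForm w} := by
    rw [hI, ← adjoinSeq_sup, ← linIdeal_bot, linIdeal_sup_span, bot_sup_eq]
  rw [hB] at hsocB
  obtain ⟨j, hj, a', ha', ha'B, ha'f⟩ := exists_notMem_sup_span hIhom (linForm_mem w) hw ha haI haf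
  obtain ⟨b, hb, hab⟩ := exists_mul_notMem hsocB (by omega) ha' ha'B
  have hsep := separates_prod Finset.univ
    (fun p : support f => p.1.asHomogeneousIdeal.toIdeal) (order f) (linForm_mem w)
    (fun p => exists_eq_linIdeal_annih hdim p.2) (fun p => hwp _ ⟨p.1, p.2, rfl⟩)
  obtain ⟨⟨H, hH, hHK⟩, hsep⟩ := hsep
  obtain ⟨c, -, hbc⟩ := hsep _ (by omega) b hb
  set N := ∑ p : support f, order f p
  have ha'J : ∀ x ∈ J f, a' * x ∈ I := by
    intro x hx
    obtain ⟨y, hy⟩ := mem_sup_span_iff.1 (J_le_sup f hx)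
    have : a' * x = a' * (x - f 0 * y) + a' * f 0 * y := by ring
    rw [this]
    exact I.add_mem (I.mul_mem_left _ hy) (I.mul_mem_right _ ha'f)
  have hpow : ∀ (M : ℕ) (u : S n), linForm w ^ M * u ∈ I → u ∈ I := by
    intro M
    induction M with
    | zero => intro u hu; simpa using hu
    | succ M ih =>
      intro u hu
      rw [pow_succ, mul_assoc] at hu
      exact hw _ (ih _ hu)
  -- Local containment of the product in `J_f` becomes global here: `l ^ M * h ∈ J_f` gives `l ^ M *
  -- (a' * h) ∈ I`, and `l` is cancelled.
  have hkey : ∀ x ∈ Ideal.span H, a' * x ∈ I := by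
    intro x hx
    have hle : Ideal.span H ≤ I.colon {a'} := by
      refine Ideal.span_le.2 fun h hh => ?_
      have hprod : h ∈ ∏ p : support f, p.1.asHomogeneousIdeal.toIdeal ^ order f p := by
        rw [hHK]; exact Ideal.subset_span hh
      obtain ⟨M, hM⟩ := exists_pow_mul_mem_J hf (linForm_mem w) one_pos (hH hh) fun p =>
        exists_mul_mem_of_mem_pow_order hdim p
          ((Ideal.prod_le_inf.trans (Finset.inf_le (Finset.mem_univ p))) hprod)
      rw [SetLike.mem_coe, Submodule.mem_colon_singleton, smul_eq_mul]
      refine hpow M _ ?_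
      have := ha'J _ hM
      convert this using 1
      ring
    have := hle hx
    rwa [Submodule.mem_colon_singleton, smul_eq_mul, mul_comm] at this
  rw [hHK] at hbc
  apply hab
  -- The bound on `m` gives `N ≤ n(e-1) - j`, so the exponent `n(e-1) - j + 1 - N` is positive and
  -- one factor `l` splits off.
  refine mem_sup_span_iff.2 ⟨linForm w ^ (n * (e - 1) - j - N) * (a' * c), ?_⟩
  convert hkey _ hbc using 1
  rw [show n * (e - 1) - j + 1 - N = n * (e - 1) - j - N + 1 by omega]
  ring

/-! ### Relations on a regular sequence -/

/-- The submodule of Koszul relations in `Sⁿ⁺¹`. -/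
def koszul (f : Fin (n + 1) → S n) : Submodule (S n) (Fin (n + 1) → S n) :=
  Submodule.span (S n) {x | ∃ i j, x = f i • Pi.single j 1 - f j • Pi.single i 1}

theorem mul_mem_span_of_relation (f : Fin (n + 1) → S n) {s : Finset (Fin (n + 1))}
    {j : Fin (n + 1)} {v : Fin (n + 1) → S n} (hv : ∀ i ∉ s, i ≠ j → v i = 0)
    (hrel : ∑ i, v i * f i = 0) (hj : j ∉ s) : v j * f j ∈ Ideal.span (f '' s) := by
  classical
  have h1 : ∑ i ∈ insert j s, v i * f i = 0 := by
    rw [← hrel]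
    refine Finset.sum_subset (Finset.subset_univ _) fun i _ hi => ?_
    rw [Finset.mem_insert, not_or] at hi
    rw [hv i hi.2 hi.1, zero_mul]
  rw [Finset.sum_insert hj] at h1
  rw [eq_neg_of_add_eq_zero_left h1]
  exact Ideal.neg_mem_iff _ |>.2 (Ideal.sum_mem _ fun i hi =>
    Ideal.mul_mem_left _ _ (Ideal.subset_span ⟨i, hi, rfl⟩))

/-- Writing `v j = ∑ c t * f t` over `s`, the Koszul relation `y` with these coefficients has the
same `j`-th entry as `v`, so `v - y` is a relation supported on `s`. -/
theorem mem_koszul_of_mem_span (f : Fin (n + 1) → S n) {s : Finset (Fin (n + 1))}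
    (hs : ∀ v : Fin (n + 1) → S n, (∀ i ∉ s, v i = 0) → ∑ i, v i * f i = 0 → v ∈ koszul f)
    {j : Fin (n + 1)} {v : Fin (n + 1) → S n} (hv : ∀ i ∉ s, i ≠ j → v i = 0)
    (hrel : ∑ i, v i * f i = 0) (hj : j ∉ s)
    (hvj : v j ∈ Ideal.span (f '' s)) : v ∈ koszul f := by
  classical
  obtain ⟨c, hc⟩ := (Submodule.mem_span_image_finset_iff_exists_fun' (S n)).1 hvj
  let y : Fin (n + 1) → S n :=
    ∑ t ∈ s, c t • (f t • Pi.single j 1 - f j • Pi.single t 1 : Fin (n + 1) → S n)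
  have hy : y ∈ koszul f := Submodule.sum_mem _ fun t _ =>
    Submodule.smul_mem _ _ (Submodule.subset_span ⟨t, j, rfl⟩)
  have hyrel : ∑ i, y i * f i = 0 := by
    let φ : (Fin (n + 1) → S n) →ₗ[S n] S n := Fintype.linearCombination (S n) f
    have hφ : ∀ x, ∑ i, x i * f i = φ x := fun x => by
      simp [φ, Fintype.linearCombination_apply]
    rw [hφ, map_sum]
    refine Finset.sum_eq_zero fun t _ => ?_
    simp [φ, mul_comm]
  have hyi : ∀ i ∉ s, y i = if i = j then v j else 0 := by
    intro i hi
    simp only [y, Finset.sum_apply, Pi.smul_apply, Pi.sub_apply, smul_eq_mul]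
    split_ifs with hij
    · subst hij
      rw [← hc]
      refine Finset.sum_congr rfl fun t ht => ?_
      have : i ≠ t := fun h => hi (h ▸ ht)
      simp [this]
    · refine Finset.sum_eq_zero fun t ht => ?_
      have : i ≠ t := fun h => hi (h ▸ ht)
      simp [this, hij]
  have hsub : v - y ∈ koszul f := by
    refine hs _ (fun i hi => ?_) ?_
    · rw [Pi.sub_apply, hyi i hi]
      split_ifs with hij
      · rw [hij, sub_self]
      · rw [hv i hi hij, sub_zero]
    · simp only [Pi.sub_apply, sub_mul, Finset.sum_sub_distrib, hrel, hyrel, sub_zero]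
  have := Submodule.add_mem _ hsub hy
  rwa [sub_add_cancel] at this

/-- The indices `1, …, t`. -/
def firstIndices (n t : ℕ) : Finset (Fin (n + 1)) :=
  Finset.univ.filter fun i => 0 < (i : ℕ) ∧ (i : ℕ) ≤ t

theorem span_firstIndices (f : Fin (n + 1) → S n) {t : ℕ} (ht : t ≤ n) :
    Ideal.span (f '' firstIndices n t) = adjoinSeq ⊥ (cyc f) t := by
  rw [adjoinSeq, bot_sup_eq]
  congr 1
  ext x
  simp only [firstIndices, Finset.coe_filter, Finset.mem_univ, true_and, Set.mem_image,
    Set.mem_ofPred_eq, Set.mem_Iio]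
  constructor
  · rintro ⟨i, ⟨hi, hit⟩, rfl⟩
    refine ⟨i - 1, by omega, ?_⟩
    rw [cyc_of_lt f (by omega)]
    congr 1
    ext
    simp
    omega
  · rintro ⟨i, hi, rfl⟩
    refine ⟨Fin.succ ⟨i, by omega⟩, ?_, (cyc_of_lt f (by omega)).symm⟩
    simp
    omega

theorem mem_koszul_of_firstIndices {f : Fin (n + 1) → S n} (h : RegularSeqMod ⊥ (cyc f) n)
    {t : ℕ} (ht : t ≤ n) (v : Fin (n + 1) → S n) (hv : ∀ i ∉ firstIndices n t, v i = 0)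
    (hrel : ∑ i, v i * f i = 0) : v ∈ koszul f := by
  induction t generalizing v with
  | zero =>
    have : v = 0 := by
      funext i
      refine hv i ?_
      simp [firstIndices]
      omega
    rw [this]
    exact Submodule.zero_mem _
  | succ t ih =>
    have hj : (Fin.succ ⟨t, ht⟩ : Fin (n + 1)) ∉ firstIndices n t := by simp [firstIndices]
    have hv' : ∀ i ∉ firstIndices n t, i ≠ Fin.succ ⟨t, ht⟩ → v i = 0 := by
      intro i hi hne
      refine hv i fun hmem => ?_
      simp only [firstIndices, Finset.mem_filter, Finset.mem_univ, true_and] at hi hmem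
      apply hne
      ext
      simp
      omega
    refine mem_koszul_of_mem_span f (fun v hv hrel => ih (by omega) v hv hrel) hv' hrel hj ?_
    rw [span_firstIndices f (by omega)]
    apply h t ht
    rw [← span_firstIndices f (by omega), mul_comm, cyc_of_lt f ht]
    exact mul_mem_span_of_relation f hv' hrel hj

/-- A relation whose first coefficient lies in `(f₁, …, fₙ)` is a Koszul relation. -/
theorem mem_koszul_of_mem_adjoinSeq {f : Fin (n + 1) → S n} (h : RegularSeqMod ⊥ (cyc f) n)
    {v : Fin (n + 1) → S n} (hrel : ∑ i, v i * f i = 0)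
    (hv : v 0 * f 0 ∈ adjoinSeq ⊥ (cyc f) n → v 0 ∈ adjoinSeq ⊥ (cyc f) n) : v ∈ koszul f := by
  have h0 : (0 : Fin (n + 1)) ∉ firstIndices n n := by simp [firstIndices]
  have hv' : ∀ i ∉ firstIndices n n, i ≠ 0 → v i = 0 := by
    intro i hi hne
    refine absurd ?_ hi
    simp only [firstIndices, Finset.mem_filter, Finset.mem_univ, true_and]
    have := Fin.val_ne_zero_iff.2 hne
    omega
  rw [← span_firstIndices f le_rfl] at hv
  exact mem_koszul_of_mem_span f (fun v hv hrel => mem_koszul_of_firstIndices h le_rfl v hv hrel)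
    hv' hrel h0 (hv (mul_mem_span_of_relation f hv' hrel h0))

/-! ### Contraction on the exterior algebra -/

section Contraction

variable {R M : Type*} [CommRing R] [AddCommGroup M] [Module R M] (d : Module.Dual R M)

/-- Contraction of exterior forms with a linear functional. -/
abbrev contract : ExteriorAlgebra R M →ₗ[R] ExteriorAlgebra R M :=
  CliffordAlgebra.contractLeft d

theorem contract_ι_mul (a : M) (b : ExteriorAlgebra R M) :
    contract d (ExteriorAlgebra.ι R a * b) = d a • b - ExteriorAlgebra.ι R a * contract d b :=
  CliffordAlgebra.contractLeft_ι_mul d a b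

theorem contract_ιMulti_eq_zero {k : ℕ} (v : Fin k → M) (h : ∀ i, d (v i) = 0) :
    contract d (ExteriorAlgebra.ιMulti R k v) = 0 := by
  induction k with
  | zero => rw [ExteriorAlgebra.ιMulti_zero_apply]; exact CliffordAlgebra.contractLeft_one _ d
  | succ k ih =>
    rw [ExteriorAlgebra.ιMulti_succ_apply, contract_ι_mul, h, zero_smul,
      ih (Matrix.vecTail v) (fun i => h i.succ), mul_zero, sub_zero]

theorem ι_mul_mem_exteriorPower {k : ℕ} (a : M) {b : ExteriorAlgebra R M} (hb : b ∈ ⋀[R]^k M) :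
    ExteriorAlgebra.ι R a * b ∈ ⋀[R]^(k + 1) M := by
  rw [ExteriorAlgebra.exteriorPower, pow_succ']
  exact Submodule.mul_mem_mul ⟨a, rfl⟩ hb

theorem contract_ιMulti_mem {k : ℕ} (v : Fin (k + 1) → M) :
    contract d (ExteriorAlgebra.ιMulti R (k + 1) v) ∈ ⋀[R]^k M := by
  induction k with
  | zero =>
    rw [ExteriorAlgebra.ιMulti_succ_apply, contract_ι_mul, contract_ιMulti_eq_zero d _ finZeroElim,
      mul_zero, sub_zero]
    exact Submodule.smul_mem _ _ (ExteriorAlgebra.ιMulti_range R 0 ⟨_, rfl⟩)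
  | succ k ih =>
    rw [ExteriorAlgebra.ιMulti_succ_apply, contract_ι_mul]
    exact Submodule.sub_mem _
      (Submodule.smul_mem _ _ (ExteriorAlgebra.ιMulti_range R (k + 1) ⟨_, rfl⟩))
      (ι_mul_mem_exteriorPower _ (ih _))

theorem contract_mem {k : ℕ} {x : ExteriorAlgebra R M} (hx : x ∈ ⋀[R]^(k + 1) M) :
    contract d x ∈ ⋀[R]^k M := by
  rw [← ExteriorAlgebra.ιMulti_span_fixedDegree] at hx
  induction hx using Submodule.span_induction with
  | mem x hx => obtain ⟨v, rfl⟩ := hx; exact contract_ιMulti_mem d v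
  | zero => rw [map_zero]; exact Submodule.zero_mem _
  | add x y _ _ hx hy => rw [map_add]; exact Submodule.add_mem _ hx hy
  | smul r x _ hx => rw [map_smul]; exact Submodule.smul_mem _ _ hx

end Contraction

/-! ### From `n`-forms to coefficient vectors -/

/-- The volume form `dx₀ ∧ ⋯ ∧ dxₙ`. -/
def vol (n : ℕ) : Forms n := ExteriorAlgebra.ιMulti (S n) (n + 1) dx

/-- The `n`-form obtained by contracting the volume form with `∂/∂xᵢ`. -/
def coForm (i : Fin (n + 1)) : Forms n := contract (LinearMap.proj i) (vol n)

/-- The `n`-form with a given coefficient vector with respect to the forms `coForm i`. -/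
def toForm (n : ℕ) : (Fin (n + 1) → S n) →ₗ[S n] Forms n :=
  Fintype.linearCombination (S n) coForm

theorem toForm_apply (v : Fin (n + 1) → S n) : toForm n v = ∑ i, v i • coForm i := by
  simp [toForm, Fintype.linearCombination_apply]

theorem toForm_single (i : Fin (n + 1)) (a : S n) : toForm n (Pi.single i a) = a • coForm i := by
  simp [toForm]

theorem omega_eq (f : Fin (n + 1) → S n) : omega f = f := by
  funext i
  simp [omega, dx, Finset.sum_apply, Pi.single_apply]

theorem wedge_apply (f : Fin (n + 1) → S n) (x : Forms n) :
    wedge f x = ExteriorAlgebra.ι (S n) (omega f) * x := rfl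

theorem ι_dx_mul_ιMulti {k : ℕ} (j : Fin (n + 1)) (s : Fin k → Fin (n + 1)) :
    ExteriorAlgebra.ι (S n) (dx j) * ExteriorAlgebra.ιMulti (S n) k (fun i => dx (s i)) =
      ExteriorAlgebra.ιMulti (S n) (k + 1)
        (fun i => dx (Fin.cons (α := fun _ => Fin (n + 1)) j s i)) := by
  rw [ExteriorAlgebra.ιMulti_succ_apply]
  rfl

theorem wedge_vol (f : Fin (n + 1) → S n) : wedge f (vol n) = 0 := by
  rw [wedge_apply, omega, map_sum, Finset.sum_mul]
  refine Finset.sum_eq_zero fun j _ => ?_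
  rw [map_smul, smul_mul_assoc, vol]
  have h1 := ι_dx_mul_ιMulti j (id : Fin (n + 1) → Fin (n + 1))
  have h2 : ¬ Function.Injective fun i => (dx (Fin.cons (α := fun _ => Fin (n + 1)) j id i) :
      OneForms n) := by
    intro h
    have : (0 : Fin (n + 2)) = Fin.succ j := h (by simp)
    exact Fin.succ_ne_zero j this.symm
  rw [ExteriorAlgebra.ιMulti_eq_zero_of_not_inj h2] at h1
  rw [show (ExteriorAlgebra.ιMulti (S n) (n + 1)) dx =
    ExteriorAlgebra.ιMulti (S n) (n + 1) (fun i => dx (id i)) from rfl, h1, smul_zero]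

theorem contract_wedge (f : Fin (n + 1) → S n) (i : Fin (n + 1)) (x : Forms n) :
    contract (LinearMap.proj i) (wedge f x) =
      f i • x - wedge f (contract (LinearMap.proj i) x) := by
  rw [wedge_apply, wedge_apply, contract_ι_mul, LinearMap.proj_apply, omega_eq]

theorem wedge_coForm (f : Fin (n + 1) → S n) (i : Fin (n + 1)) :
    wedge f (coForm i) = f i • vol n := by
  have := contract_wedge f i (vol n)
  rw [wedge_vol, map_zero] at this
  exact (sub_eq_zero.1 this.symm).symm

/-- This exhibits each Koszul relation as `ω` wedged with a double contraction of the volume form.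
-/
theorem wedge_contract_coForm (f : Fin (n + 1) → S n) (i j : Fin (n + 1)) :
    wedge f (contract (LinearMap.proj i) (coForm j)) = f i • coForm j - f j • coForm i := by
  have := contract_wedge f i (coForm j)
  rw [wedge_coForm, map_smul] at this
  rw [coForm, coForm] at *
  rw [this]
  abel

theorem wedge_toForm (f v : Fin (n + 1) → S n) :
    wedge f (toForm n v) = (∑ i, v i * f i) • vol n := by
  rw [toForm_apply, map_sum, Finset.sum_smul]
  refine Finset.sum_congr rfl fun i _ => ?_
  rw [map_smul, wedge_coForm, smul_smul]

theorem eq_zero_of_smul_vol_eq_zero {a : S n} (h : a • vol n = 0) : a = 0 := by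
  -- The determinant, extended by zero to other degrees, reads off the coefficient of the volume
  -- form.
  let φ : Forms n →ₗ[S n] S n := ExteriorAlgebra.liftAlternating
    (Pi.single (n + 1) (Pi.basisFun (S n) (Fin (n + 1))).det)
  have h1 : φ (vol n) = 1 := by
    rw [vol, ExteriorAlgebra.liftAlternating_apply_ιMulti, Pi.single_eq_same]
    have : (dx : Fin (n + 1) → OneForms n) = Pi.basisFun (S n) (Fin (n + 1)) := by
      funext i
      simp [dx]
    rw [this]
    exact Module.Basis.det_self _
  have h2 := congrArg φ h
  rwa [map_smul, h1, smul_eq_mul, mul_one, map_zero] at h2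

/-- For injective `s` with missing index `j`, wedging with `dxⱼ` gives `±vol`, and contracting with
`∂/∂xⱼ` recovers the form. Otherwise the form is zero. -/
theorem exists_ιMulti_eq_smul_coForm (s : Fin n → Fin (n + 1)) :
    ∃ (c : ℤ) (j : Fin (n + 1)),
      ExteriorAlgebra.ιMulti (S n) n (fun i => dx (s i)) = c • (coForm j : Forms n) := by
  by_cases hs : Function.Injective s
  swap
  · refine ⟨0, 0, ?_⟩
    rw [zero_smul]
    apply ExteriorAlgebra.ιMulti_eq_zero_of_not_inj
    intro h
    exact hs fun i j hij => h (congrArg dx hij)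
  obtain ⟨j, hj⟩ : ∃ j, j ∉ Set.range s := by
    by_contra! hcon
    have := Fintype.card_le_of_surjective s hcon
    simp at this
  have hinj : Function.Injective (Fin.cons (α := fun _ => Fin (n + 1)) j s) :=
    Fin.cons_injective_iff.2 ⟨hj, hs⟩
  let σ : Equiv.Perm (Fin (n + 1)) :=
    Equiv.ofBijective _ (Finite.injective_iff_bijective.1 hinj)
  have h1 : ExteriorAlgebra.ι (S n) (dx j) *
      ExteriorAlgebra.ιMulti (S n) n (fun i => dx (s i)) = Equiv.Perm.sign σ • vol n := by
    rw [ι_dx_mul_ιMulti]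
    exact (ExteriorAlgebra.ιMulti (S n) (n + 1)).map_perm dx σ
  have h2 := congrArg (contract (LinearMap.proj (R := S n) (φ := fun _ => S n) j)) h1
  rw [contract_ι_mul, contract_ιMulti_eq_zero, mul_zero, sub_zero] at h2
  · refine ⟨Equiv.Perm.sign σ, j, ?_⟩
    rw [LinearMap.proj_apply, dx, Pi.single_eq_same, one_smul] at h2
    rw [show (fun i => dx (s i)) = fun i => (Pi.single (s i) 1 : OneForms n) from rfl] at *
    refine h2.trans ?_
    rw [Units.smul_def, map_zsmul]
    rfl
  · intro i
    have : j ≠ s i := fun h => hj ⟨i, h.symm⟩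
    simp [dx, this]

theorem exists_toForm_eq {m : ℕ} {η : Forms n} (hη : η ∈ homogeneousForms n m) :
    ∃ v : Fin (n + 1) → S n, (∀ i, v i ∈ grading n m) ∧ toForm n v = η := by
  induction hη using Submodule.span_induction with
  | mem η h =>
    obtain ⟨a, ha, s, rfl⟩ := h
    obtain ⟨c, j, hc⟩ := exists_ιMulti_eq_smul_coForm s
    refine ⟨Pi.single j (c • a), fun i => ?_, ?_⟩
    · by_cases hij : i = j
      · subst hij
        rw [Pi.single_eq_same]
        exact zsmul_mem ha c
      · rw [Pi.single_eq_of_ne hij]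
        exact Submodule.zero_mem _
    · rw [toForm_single, hc, smul_comm a c, smul_assoc]
  | zero => exact ⟨0, fun i => Submodule.zero_mem _, map_zero _⟩
  | add x y _ _ hx hy =>
    obtain ⟨v, hv, rfl⟩ := hx
    obtain ⟨w, hw, rfl⟩ := hy
    exact ⟨v + w, fun i => Submodule.add_mem _ (hv i) (hw i), map_add _ _ _⟩
  | smul c x _ hx =>
    obtain ⟨v, hv, rfl⟩ := hx
    refine ⟨(C c : S n) • v, fun i => ?_, ?_⟩
    · rw [Pi.smul_apply, smul_eq_mul, ← smul_eq_C_mul]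
      exact Submodule.smul_mem _ _ (hv i)
    · rw [map_smul, ← algebraMap_eq, algebraMap_smul]

theorem vol_mem : vol n ∈ kForms n (n + 1) := ExteriorAlgebra.ιMulti_range _ _ ⟨_, rfl⟩

theorem toForm_mem_KR (f : Fin (n + 1) → S n) {v : Fin (n + 1) → S n} (hv : v ∈ koszul f) :
    toForm n v ∈ KR f := by
  induction hv using Submodule.span_induction with
  | mem v h =>
    obtain ⟨i, j, rfl⟩ := h
    rw [map_sub, map_smul, map_smul, toForm_single, toForm_single, one_smul, one_smul]
    cases n with
    | zero =>
      -- With a single variable there are no nontrivial Koszul relations, in agreement with `Ω⁻¹ =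
      -- 0`.
      rw [Subsingleton.elim (α := Fin 1) i j, sub_self]
      exact Submodule.zero_mem _
    | succ k =>
      rw [← wedge_contract_coForm]
      exact ⟨_, contract_mem _ (contract_mem _ vol_mem), rfl⟩
  | zero => rw [map_zero]; exact Submodule.zero_mem _
  | add x y _ _ hx hy => rw [map_add]; exact Submodule.add_mem _ hx hy
  | smul r x _ hx => rw [map_smul]; exact Submodule.smul_mem _ _ hx

/-! ### Vanishing of the graded piece -/

theorem ERdeg_eq_bot {e : ℕ} (he : 0 < e) {f : Fin (n + 1) → S n}
    (hf : ∀ j, f j ∈ grading n e) (hJ : IsOneDimCI f) {m : ℕ}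
    (hm : m + ∑ᶠ p : support f, order f p ≤ n * (e - 1)) : ERdeg f m = ⊥ := by
  rw [eq_bot_iff]
  rintro _ ⟨⟨η, hη⟩, hdeg, rfl⟩
  obtain ⟨v, hv, hvη⟩ := exists_toForm_eq (η := η) hdeg
  refine (Submodule.Quotient.mk_eq_zero _).2 ?_
  change η ∈ KR f
  rw [← hvη]
  apply toForm_mem_KR
  have hrel : ∑ i, v i * f i = 0 := by
    have h1 : wedge f η = 0 := hη.2
    rw [← hvη, wedge_toForm] at h1
    exact eq_zero_of_smul_vol_eq_zero h1
  exact mem_koszul_of_mem_adjoinSeq (regularSeqMod_cyc hJ.2) hrel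
    (mem_adjoinSeq_of_mul_mem he hf hJ hm (hv 0))

end EssentialRelations

end

open EssentialRelations in
theorem theorem1p2 (n e : ℕ) (he : 0 < e) (f : Fin (n + 1) → S n)
    (hf : ∀ j, f j ∈ grading n e) (hJ : IsOneDimCI f) :
    (support f).Finite ∧
    (∀ p : support f, IsArtinianRing (localRing f p)) ∧
    ∀ m : ℕ, (m : ℤ) ≤ n * ((e : ℤ) - 1) - ((∑ᶠ p : support f, order f p : ℕ) : ℤ) →
      ERdeg f m = ⊥ := by
  refine ⟨finite_support hJ.1, isArtinianRing_localRing hJ.1, fun m hm => ?_⟩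
  refine ERdeg_eq_bot he hf hJ ?_
  zify [he]
  linarith
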